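/- Let $p\ge 1$ be real and $T>0$. For $t\in[0,T)$ let $K_t\subset\mathbb{R}^2$ be convex bodies with nonempty interior, symmetric about the origin, with smooth boundary $\gamma_t=\partial K_t$ of positive curvature. Suppose $\gamma_t$ is parametrized by embeddings $x(\cdot,t):\mathbb{S}^1\to\mathbb{R}^2$, where $x$ is smooth on $\mathbb{S}^1\times[0,T)$, and that $K_t$ evolves by the contracting $p$-centro affine flow $$\frac{\partial x}{\partial t}=-\Big(\frac{\kappa}{s^3}\Big)^{\frac{p}{p+2}-\frac13}\kappa^{\frac13}\,z\qquad\text{up to tangential motion, i.e.}\qquad \Big\langle\frac{\partial x}{\partial t},z\Big\rangle=-\Big(\frac{\kappa}{s^3}\Big)^{\frac{p}{p+2}-\frac13}\kappa^{\frac13},$$ where $z$ is the outer unit normal, $\kappa$ the curvature and $s=\langle x,z\rangle$ the support function. (Equivalently, as a function of the normal angle $\theta$ the support function satisfies $\partial_t s=-s^{1-\frac{3p}{p+2}}(s_{\theta\theta}+s)^{-\frac{p}{p+2}}$.) Let $A(t)$ be the area of $K_t$ and let $$\Omega_p(t)=\int_{\mathbb{S}^1}\frac{s}{\kappa}\Big(\frac{\kappa}{s^3}\Big)^{\frac{p}{p+2}}d\theta$$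 be the $p$-affine length of $\gamma_t$, where $\theta$ is the normal angle. Let $\sigma=(\kappa/s^3)^{-1/3}$ be the affine support function, and let $\mathfrak{s}$ be the affine arclength, $d\mathfrak{s}=[\gamma_u,\gamma_{uu}]^{1/3}du$ for any counterclockwise parameter $u$ of $\gamma=\gamma_t$, where $[\cdot,\cdot]$ is the determinant of two vectors; $\sigma_{\mathfrak{s}}$ is the derivative of $\sigma$ with respect to $\mathfrak{s}$. Then $\Omega_p$ is differentiable on $[0,T)$ (one-sidedly at $0$), and for every $t\in[0,T)$: if $1\le p\le 2$, then $$\frac{d}{dt}\Omega_p\ \ge\ \frac{p-2}{p+2}\,\frac{\Omega_p^2}{A}+\frac{18(p-1)p^2}{(p+2)^3}\int_{\gamma_t}\sigma^{-\frac{6p}{p+2}}\sigma_{\mathfrak{s}}^2\,d\mathfrak{s},$$ while if $p\ge 2$, then $$\frac{d}{dt}\Omega_p\ \ge\ \frac{p-2}{p+2}\,\frac{\Omega_p^2}{A}+\frac{18p^2}{(p+2)^3}\int_{\gamma_t}\sigma^{-\frac{6p}{p+2}}\sigma_{\mathfrak{s}}^2\,d\mathfrak{s}.$$ -/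

import Mathlib

open Set MeasureTheory
open scoped ContDiff

namespace CentroAffine

noncomputable section

/-- The Euclidean plane. -/
abbrev Plane : Type := EuclideanSpace ℝ (Fin 2)

/-- `[u, v]`, the determinant of the matrix with rows `u` and `v`. -/
def bracket (u v : Plane) : ℝ := u 0 * v 1 - u 1 * v 0

/-- `γ` is a smooth, closed (`2π`-periodic), embedded, counterclockwise parametrization, with
everywhere positive curvature, of the boundary of the centrally symmetric convex body `K` with
nonempty interior, whose center of symmetry is the origin. The parameter is arbitrary: it need not
be the normal angle. -/
structure IsSymBoundary (K : ConvexBody Plane) (γ : ℝ → Plane) : Prop where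
  interior_nonempty : (interior (K : Set Plane)).Nonempty
  symmetric : ∀ y ∈ K, -y ∈ K
  smooth : ContDiff ℝ ∞ γ
  periodic : Function.Periodic γ (2 * Real.pi)
  injOn : InjOn γ (Ico 0 (2 * Real.pi))
  range_eq : range γ = frontier (K : Set Plane)
  counterclockwise : ∀ u, 0 < bracket (γ u) (deriv γ u)
  curvature_pos : ∀ u, 0 < bracket (deriv γ u) (deriv (deriv γ) u)

/-- The outer unit normal `z` of a counterclockwise curve: the unit tangent turned clockwise by a
right angle. -/
def outerNormal (γ : ℝ → Plane) (u : ℝ) : Plane :=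
  (‖deriv γ u‖)⁻¹ • !₂[deriv γ u 1, -(deriv γ u 0)]

/-- The support function `s = ⟨γ, z⟩`, as a function of the parameter of the curve. -/
def supportFn (γ : ℝ → Plane) (u : ℝ) : ℝ := inner ℝ (γ u) (outerNormal γ u)

/-- The Euclidean curvature `κ`. -/
def curvature (γ : ℝ → Plane) (u : ℝ) : ℝ :=
  bracket (deriv γ u) (deriv (deriv γ) u) / ‖deriv γ u‖ ^ 3

/-- The centro-affine curvature `κ₀ = κ / s³`. -/
def centroAffineCurvature (γ : ℝ → Plane) (u : ℝ) : ℝ := curvature γ u / supportFn γ u ^ 3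

/-- The integral over the unit circle, with respect to the normal angle `θ`, of a function given
in the parameter `u` of the curve: `dθ = κ ‖γ'(u)‖ du` (which is `du` if `u` is the normal
angle). -/
def normalAngleIntegral (γ : ℝ → Plane) (f : ℝ → ℝ) : ℝ :=
  ∫ u in (0 : ℝ)..(2 * Real.pi), f u * (curvature γ u * ‖deriv γ u‖)

/-- The `p`-affine length `Ω_p = ∫ (s / κ) (κ / s³)^(p / (p + 2)) dθ`. -/
def affineLength (p : ℝ) (γ : ℝ → Plane) : ℝ :=
  normalAngleIntegral γ fun u =>
    supportFn γ u / curvature γ u * centroAffineCurvature γ u ^ (p / (p + 2))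

/-- `𝔤 = [γ', γ'']^(1/3)`, the density of the affine arclength: `d𝔰 = 𝔤 du`. -/
def affineSpeed (γ : ℝ → Plane) (u : ℝ) : ℝ :=
  bracket (deriv γ u) (deriv (deriv γ) u) ^ (1 / 3 : ℝ)

/-- The derivative `f_𝔰` of a function along the curve with respect to affine arclength. -/
def affineDeriv (γ : ℝ → Plane) (f : ℝ → ℝ) (u : ℝ) : ℝ := deriv f u / affineSpeed γ u

/-- The integral `∫_γ f d𝔰` with respect to affine arclength. -/
def affineIntegral (γ : ℝ → Plane) (f : ℝ → ℝ) : ℝ :=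
  ∫ u in (0 : ℝ)..(2 * Real.pi), f u * affineSpeed γ u

/-- The affine support function `σ = κ₀^(-1/3)`. -/
def affineSupport (γ : ℝ → Plane) (u : ℝ) : ℝ := centroAffineCurvature γ u ^ (-(1 / 3) : ℝ)

/-- `∫_γ σ^(-6p/(p+2)) σ_𝔰² d𝔰`. -/
def affineEnergy (p : ℝ) (γ : ℝ → Plane) : ℝ :=
  affineIntegral γ fun u =>
    affineSupport γ u ^ (-(6 * p) / (p + 2)) * affineDeriv γ (affineSupport γ) u ^ 2

/-- The area of a convex body of the plane. -/
def area (K : ConvexBody Plane) : ℝ := (volume (K : Set Plane)).toReal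

/-- `x(·, t)`, `t ∈ [0, T)`, is a smooth family of parametrizations of the boundaries of centrally
symmetric convex bodies `K t` evolving by the contracting `p`-centro affine flow
`∂x/∂t = -(κ / s³)^(p/(p+2) - 1/3) κ^(1/3) z`, up to tangential motion, which only changes the
parametrization. So `x` may move in the direction of the normal `z`, or in the direction of the
affine normal, i.e. `∂x/∂t = σ^(1 - 3p/(p+2)) γ_𝔰𝔰`, or be parametrized by the normal angle at each
time, in which case the equation reads
`∂s/∂t = -s^(1 - 3p/(p+2)) 𝔯^(-p/(p+2))` for the support function. -/
structure IsContractingFlow (p T : ℝ) (K : ℝ → ConvexBody Plane) (x : ℝ → ℝ → Plane) : Prop where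
  smooth : ContDiffOn ℝ ∞ (fun w : ℝ × ℝ => x w.1 w.2) (univ ×ˢ Ico 0 T)
  boundary : ∀ t ∈ Ico 0 T, IsSymBoundary (K t) (fun u => x u t)
  evolution : ∀ u, ∀ t ∈ Ico 0 T,
    inner ℝ (derivWithin (fun τ => x u τ) (Ico 0 T) t) (outerNormal (fun v => x v t) u) =
      -(centroAffineCurvature (fun v => x v t) u ^ (p / (p + 2) - 1 / 3) *
        curvature (fun v => x v t) u ^ (1 / 3 : ℝ))

end

end CentroAffine

/-!
Write `a = p / (p + 2)`, `k` for the centro-affine curvature `κ₀`, `φ = k ^ a` and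
`D = [γ, γ']`. All quantities are expressed in an arbitrary parameter `u` of the curve through the
measure `D du`, whose total mass is twice the area (`IsSymBoundary.area_eq`). For it the curve
satisfies Hill's equation `γ_vv = -k γ`, `dv = D du` (`IsSymBoundary.hasDerivAt_hill`),
the affine length is `Ω = ∫ φ D du`, and the flow equation becomes `[x_t, x_u] = -φ D`, that is,
`x_t = -φ x + ψ x_u` with an arbitrary tangential part `ψ`.

Differentiating the integrand of `Ω` gives
`(φ D)_t = (4 a - 2) φ² D + (1 - a) (φ_u)² / (k D)` up to the `u`-derivative of a periodic function
(`IsSymBoundary.hasDerivAt_lengthRate_primitive`); hence `Ω' = (4 a - 2) I + (1 - a) J` with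
`I = ∫ φ² D du` and `J = ∫ (φ_u)² / (k D) du` (`IsContractingFlow.hasDerivWithinAt_affineLength`).
Here `4 a - 2 = 2 (p - 2) / (p + 2)`, and `J` is `9 a²` times the affine energy.

For `p ≥ 2` the claim is then the Cauchy-Schwarz inequality `Ω² ≤ 2 A I`
(`IsSymBoundary.sq_integral_le`). For `p ≤ 2` it is the opposite estimate
`I - Ω² / (2 A) ≤ J` (`IsSymBoundary.wirtinger`), which is Minkowski's inequality for the support
functions `s` and `φ s`. Because of the central symmetry it has an elementary proof: `φ` takes the
same value `c` at a point and at its antipode, `I - Ω² / (2 A) ≤ ∫ (φ - c)² D du`, and `φ - c`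
vanishes at the ends of two half curves. On each half the inequality with Dirichlet boundary values
follows from Jacobi's completion of the square, with a positive solution of the Euler-Lagrange
equation given by the tangent direction (`IsSymBoundary.wirtinger_half`).
-/

namespace CentroAffine

/-! ### Brackets, and the invariants of a curve in terms of them -/

theorem bracket_self (u : Plane) : bracket u u = 0 := by unfold bracket; ring

theorem bracket_neg_left (u v : Plane) : bracket (-u) v = -bracket u v := by
  simp [bracket]; ring

theorem bracket_neg_right (u v : Plane) : bracket u (-v) = -bracket u v := by
  simp [bracket]; ring

theorem bracket_smul_left (c : ℝ) (u v : Plane) : bracket (c • u) v = c * bracket u v := by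
  simp [bracket]; ring

theorem bracket_smul_right (c : ℝ) (u v : Plane) : bracket u (c • v) = c * bracket u v := by
  simp [bracket]; ring

theorem hasDerivWithinAt_coord {f : ℝ → Plane} {f' : Plane} {s : Set ℝ} {u : ℝ}
    (hf : HasDerivWithinAt f f' s u) (i : Fin 2) :
    HasDerivWithinAt (fun v => f v i) (f' i) s u :=
  (EuclideanSpace.proj i : Plane →L[ℝ] ℝ).hasFDerivAt.comp_hasDerivWithinAt u hf

theorem hasDerivWithinAt_bracket {f g : ℝ → Plane} {f' g' : Plane} {s : Set ℝ} {u : ℝ}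
    (hf : HasDerivWithinAt f f' s u) (hg : HasDerivWithinAt g g' s u) :
    HasDerivWithinAt (fun v => bracket (f v) (g v)) (bracket f' (g u) + bracket (f u) g') s u := by
  have h := ((hasDerivWithinAt_coord hf 0).mul (hasDerivWithinAt_coord hg 1)).sub
    ((hasDerivWithinAt_coord hf 1).mul (hasDerivWithinAt_coord hg 0))
  refine h.congr_deriv ?_
  simp only [bracket]; ring

theorem hasDerivAt_bracket {f g : ℝ → Plane} {f' g' : Plane} {u : ℝ}
    (hf : HasDerivAt f f' u) (hg : HasDerivAt g g' u) :
    HasDerivAt (fun v => bracket (f v) (g v)) (bracket f' (g u) + bracket (f u) g') u := by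
  rw [← hasDerivWithinAt_univ] at *
  exact hasDerivWithinAt_bracket hf hg

theorem contDiffOn_bracket {E : Type*} [NormedAddCommGroup E] [NormedSpace ℝ E] {f g : E → Plane}
    {s : Set E} {n : WithTop ℕ∞} (hf : ContDiffOn ℝ n f s) (hg : ContDiffOn ℝ n g s) :
    ContDiffOn ℝ n (fun v => bracket (f v) (g v)) s := by
  have hc : ∀ {f : E → Plane} (i : Fin 2), ContDiffOn ℝ n f s →
      ContDiffOn ℝ n (fun v => f v i) s := fun i hf =>
    (EuclideanSpace.proj i : Plane →L[ℝ] ℝ).contDiff.comp_contDiffOn hf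
  exact ((hc 0 hf).mul (hc 1 hg)).sub ((hc 1 hf).mul (hc 0 hg))

theorem contDiff_bracket {f g : ℝ → Plane} {n : WithTop ℕ∞} (hf : ContDiff ℝ n f)
    (hg : ContDiff ℝ n g) : ContDiff ℝ n (fun v => bracket (f v) (g v)) := by
  rw [← contDiffOn_univ] at *
  exact contDiffOn_bracket hf hg

theorem norm_deriv_mul_inner_outerNormal {γ : ℝ → Plane} {u : ℝ} (h : deriv γ u ≠ 0) (v : Plane) :
    ‖deriv γ u‖ * inner ℝ v (outerNormal γ u) = bracket v (deriv γ u) := by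
  have h' : ‖deriv γ u‖ ≠ 0 := norm_ne_zero_iff.2 h
  rw [outerNormal, inner_smul_right, ← mul_assoc, mul_inv_cancel₀ h', one_mul]
  simp [PiLp.inner_apply, Fin.sum_univ_two, bracket]; ring

/-- The density `[γ, γ']` of twice the area swept by the position vector. It is also the density
of the centro-affine invariant parameter used throughout. -/
noncomputable def areaSpeed (γ : ℝ → Plane) (u : ℝ) : ℝ := bracket (γ u) (deriv γ u)

theorem supportFn_eq {γ : ℝ → Plane} {u : ℝ} (h : deriv γ u ≠ 0) :
    supportFn γ u = areaSpeed γ u / ‖deriv γ u‖ := by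
  have h' : ‖deriv γ u‖ ≠ 0 := norm_ne_zero_iff.2 h
  rw [eq_div_iff h', mul_comm, supportFn, norm_deriv_mul_inner_outerNormal h, areaSpeed]

theorem centroAffineCurvature_eq {γ : ℝ → Plane} {u : ℝ} (h : deriv γ u ≠ 0) :
    centroAffineCurvature γ u =
      bracket (deriv γ u) (deriv (deriv γ) u) / areaSpeed γ u ^ 3 := by
  have h' : ‖deriv γ u‖ ≠ 0 := norm_ne_zero_iff.2 h
  rw [centroAffineCurvature, curvature, supportFn_eq h]
  by_cases hD : areaSpeed γ u = 0
  · simp [hD]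
  · field_simp

namespace IsSymBoundary

variable {K : ConvexBody Plane} {γ : ℝ → Plane}

theorem areaSpeed_pos (h : IsSymBoundary K γ) (u : ℝ) : 0 < areaSpeed γ u := h.counterclockwise u

theorem deriv_ne_zero (h : IsSymBoundary K γ) (u : ℝ) : deriv γ u ≠ 0 := by
  intro h0
  have := h.counterclockwise u
  simp [h0, bracket] at this

theorem centroAffineCurvature_pos (h : IsSymBoundary K γ) (u : ℝ) :
    0 < centroAffineCurvature γ u := by
  rw [centroAffineCurvature_eq (h.deriv_ne_zero u)]
  exact div_pos (h.curvature_pos u) (pow_pos (h.areaSpeed_pos u) 3)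

theorem bracket_deriv_eq (h : IsSymBoundary K γ) (u : ℝ) :
    bracket (deriv γ u) (deriv (deriv γ) u) = centroAffineCurvature γ u * areaSpeed γ u ^ 3 := by
  rw [centroAffineCurvature_eq (h.deriv_ne_zero u),
    div_mul_cancel₀ _ (pow_pos (h.areaSpeed_pos u) 3).ne']

theorem contDiff_deriv (h : IsSymBoundary K γ) : ContDiff ℝ ∞ (deriv γ) :=
  (contDiff_infty_iff_deriv.1 h.smooth).2

theorem contDiff_deriv_deriv (h : IsSymBoundary K γ) : ContDiff ℝ ∞ (deriv (deriv γ)) :=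
  (contDiff_infty_iff_deriv.1 h.contDiff_deriv).2

theorem hasDerivAt (h : IsSymBoundary K γ) (u : ℝ) : HasDerivAt γ (deriv γ u) u :=
  (h.smooth.differentiable (by simp) u).hasDerivAt

theorem hasDerivAt_deriv (h : IsSymBoundary K γ) (u : ℝ) :
    HasDerivAt (deriv γ) (deriv (deriv γ) u) u :=
  (h.contDiff_deriv.differentiable (by simp) u).hasDerivAt

theorem contDiff_areaSpeed (h : IsSymBoundary K γ) : ContDiff ℝ ∞ (areaSpeed γ) :=
  contDiff_bracket h.smooth h.contDiff_deriv

theorem continuous_areaSpeed (h : IsSymBoundary K γ) : Continuous (areaSpeed γ) :=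
  h.contDiff_areaSpeed.continuous

theorem hasDerivAt_areaSpeed (h : IsSymBoundary K γ) (u : ℝ) :
    HasDerivAt (areaSpeed γ) (bracket (γ u) (deriv (deriv γ) u)) u := by
  refine (hasDerivAt_bracket (h.hasDerivAt u) (h.hasDerivAt_deriv u)).congr_deriv ?_
  rw [bracket_self, zero_add]

theorem contDiff_centroAffineCurvature (h : IsSymBoundary K γ) :
    ContDiff ℝ ∞ (centroAffineCurvature γ) := by
  rw [show centroAffineCurvature γ = _ from
    funext fun u => centroAffineCurvature_eq (h.deriv_ne_zero u)]
  exact (contDiff_bracket h.contDiff_deriv h.contDiff_deriv_deriv).div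
    (h.contDiff_areaSpeed.pow 3) fun u => (pow_pos (h.areaSpeed_pos u) 3).ne'

theorem contDiff_rpow (h : IsSymBoundary K γ) (a : ℝ) :
    ContDiff ℝ ∞ fun u => centroAffineCurvature γ u ^ a :=
  h.contDiff_centroAffineCurvature.rpow_const_of_ne fun u => (h.centroAffineCurvature_pos u).ne'

theorem periodic_deriv (h : IsSymBoundary K γ) : Function.Periodic (deriv γ) (2 * Real.pi) := by
  intro u
  rw [← deriv_comp_add_const, funext h.periodic]

theorem periodic_areaSpeed (h : IsSymBoundary K γ) :
    Function.Periodic (areaSpeed γ) (2 * Real.pi) := by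
  intro u
  rw [areaSpeed, areaSpeed, h.periodic, h.periodic_deriv]

theorem periodic_centroAffineCurvature (h : IsSymBoundary K γ) :
    Function.Periodic (centroAffineCurvature γ) (2 * Real.pi) := by
  intro u
  have h2 : deriv (deriv γ) (u + 2 * Real.pi) = deriv (deriv γ) u := by
    rw [← deriv_comp_add_const, funext h.periodic_deriv]
  rw [centroAffineCurvature_eq (h.deriv_ne_zero _), centroAffineCurvature_eq (h.deriv_ne_zero _),
    h2, h.periodic_areaSpeed, h.periodic_deriv]

/-- With respect to the centro-affine parameter, `γ` solves Hill's equation with potential the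
centro-affine curvature. -/
theorem hasDerivAt_hill (h : IsSymBoundary K γ) (u : ℝ) :
    HasDerivAt (fun v => (areaSpeed γ v)⁻¹ • deriv γ v)
      (-(areaSpeed γ u * centroAffineCurvature γ u) • γ u) u := by
  have hD := (h.areaSpeed_pos u).ne'
  refine (((h.hasDerivAt_areaSpeed u).inv hD).smul (h.hasDerivAt_deriv u)).congr_deriv ?_
  rw [centroAffineCurvature_eq (h.deriv_ne_zero u)]
  ext i
  fin_cases i <;> (simp; field_simp; simp [areaSpeed, bracket]; ring)

theorem affineLength_eq (h : IsSymBoundary K γ) (p : ℝ) :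
    affineLength p γ = ∫ u in (0 : ℝ)..(2 * Real.pi),
      centroAffineCurvature γ u ^ (p / (p + 2)) * areaSpeed γ u := by
  refine intervalIntegral.integral_congr fun u _ => ?_
  have h' : ‖deriv γ u‖ ≠ 0 := norm_ne_zero_iff.2 (h.deriv_ne_zero u)
  have hk : curvature γ u ≠ 0 := (div_pos (h.curvature_pos u) (by positivity)).ne'
  simp only [supportFn_eq (h.deriv_ne_zero u)]
  field_simp

theorem affineEnergy_eq (h : IsSymBoundary K γ) {p : ℝ} (hp : 0 < p) :
    9 * (p / (p + 2)) ^ 2 * affineEnergy p γ = ∫ u in (0 : ℝ)..(2 * Real.pi),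
      deriv (fun v => centroAffineCurvature γ v ^ (p / (p + 2))) u ^ 2 /
        (centroAffineCurvature γ u * areaSpeed γ u) := by
  rw [affineEnergy, affineIntegral, ← intervalIntegral.integral_const_mul]
  refine intervalIntegral.integral_congr fun u _ => ?_
  have hD := h.areaSpeed_pos u
  have hk := h.centroAffineCurvature_pos u
  have hkd := (h.contDiff_centroAffineCurvature.differentiable (by simp) u).hasDerivAt
  have h1 := (hkd.rpow_const (p := p / (p + 2)) (Or.inl hk.ne')).deriv
  have h2 : deriv (affineSupport γ) u = _ :=
    (hkd.rpow_const (p := -(1 / 3)) (Or.inl hk.ne')).deriv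
  have hg : affineSpeed γ u = centroAffineCurvature γ u ^ (1 / 3 : ℝ) * areaSpeed γ u := by
    rw [affineSpeed, h.bracket_deriv_eq, Real.mul_rpow hk.le (by positivity),
      ← Real.rpow_natCast (areaSpeed γ u), ← Real.rpow_mul hD.le]
    norm_num
  simp only [affineDeriv, h1, h2, hg, affineSupport]
  set k := centroAffineCurvature γ u
  have hg0 : 0 < k ^ (1 / 3 : ℝ) := Real.rpow_pos_of_pos hk _
  have e1 : (k ^ (-(1 / 3) : ℝ)) ^ (-(6 * p) / (p + 2)) = (k ^ (p / (p + 2))) ^ 2 := by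
    rw [← Real.rpow_mul hk.le, ← Real.rpow_mul_natCast hk.le]
    congr 1; push_cast; ring
  have e2 : k ^ (-(1 / 3) - 1 : ℝ) = (k ^ (1 / 3 : ℝ))⁻¹ * k⁻¹ := by
    rw [Real.rpow_sub hk, Real.rpow_one, Real.rpow_neg hk.le]; rfl
  have e3 : k ^ (p / (p + 2) - 1) = k ^ (p / (p + 2)) * k⁻¹ := by
    rw [Real.rpow_sub hk, Real.rpow_one]; rfl
  have e4 : (k ^ (1 / 3 : ℝ)) ^ 3 = k := by
    rw [← Real.rpow_mul_natCast hk.le]; norm_num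
  rw [e1, e2, e3]
  set c := k ^ (1 / 3 : ℝ)
  have hp2 : p + 2 ≠ 0 := by positivity
  rw [← e4]
  field_simp
  ring

end IsSymBoundary

/-! ### Polar angle and antipodal points -/

namespace IsSymBoundary

variable {K : ConvexBody Plane} {γ : ℝ → Plane}

theorem neg_mem_interior (h : IsSymBoundary K γ) {y : Plane}
    (hy : y ∈ interior (K : Set Plane)) : -y ∈ interior (K : Set Plane) := by
  rw [mem_interior_iff_mem_nhds] at hy ⊢
  rw [← neg_neg y] at hy
  filter_upwards [continuous_neg.continuousAt.preimage_mem_nhds hy] with z hz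
  simpa using h.symmetric _ hz

theorem zero_mem_interior (h : IsSymBoundary K γ) : (0 : Plane) ∈ interior (K : Set Plane) := by
  obtain ⟨y, hy⟩ := h.interior_nonempty
  have := K.convex.interior hy (h.neg_mem_interior hy) (a := 1 / 2) (b := 1 / 2) (by norm_num)
    (by norm_num) (by norm_num)
  simpa using this

theorem smul_mem_interior (h : IsSymBoundary K γ) {y : Plane} (hy : y ∈ K) {c : ℝ} (hc : 0 ≤ c)
    (hc1 : c < 1) : c • y ∈ interior (K : Set Plane) := by
  have := K.convex.combo_interior_self_mem_interior h.zero_mem_interior hy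
    (a := 1 - c) (b := c) (by linarith) hc (by ring)
  simpa using this

theorem mem_frontier (h : IsSymBoundary K γ) (u : ℝ) : γ u ∈ frontier (K : Set Plane) :=
  h.range_eq ▸ mem_range_self u

theorem mem_of_mem_frontier (_h : IsSymBoundary K γ) {y : Plane}
    (hy : y ∈ frontier (K : Set Plane)) : y ∈ K :=
  K.isCompact.isClosed.frontier_subset hy

theorem mem (h : IsSymBoundary K γ) (u : ℝ) : γ u ∈ K := h.mem_of_mem_frontier (h.mem_frontier u)

/-- A ray from the origin meets the boundary at most once. -/
theorem eq_one_of_smul_mem_frontier (h : IsSymBoundary K γ) {y : Plane}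
    (hy : y ∈ frontier (K : Set Plane)) {c : ℝ} (hc : 0 < c)
    (hcy : c • y ∈ frontier (K : Set Plane)) : c = 1 := by
  rcases lt_trichotomy c 1 with h1 | h1 | h1
  · exact absurd (h.smul_mem_interior (h.mem_of_mem_frontier hy) hc.le h1) hcy.2
  · exact h1
  · have := h.smul_mem_interior (h.mem_of_mem_frontier hcy) (c := c⁻¹) (by positivity)
      (inv_lt_one_of_one_lt₀ h1)
    rw [smul_smul, inv_mul_cancel₀ hc.ne', one_smul] at this
    exact absurd this hy.2

theorem neg_mem_frontier (h : IsSymBoundary K γ) {y : Plane}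
    (hy : y ∈ frontier (K : Set Plane)) : -y ∈ frontier (K : Set Plane) := by
  refine ⟨subset_closure (h.symmetric _ (h.mem_of_mem_frontier hy)), fun hi => hy.2 ?_⟩
  simpa using h.neg_mem_interior hi

theorem injOn_Ico (h : IsSymBoundary K γ) (a : ℝ) : InjOn γ (Ico a (a + 2 * Real.pi)) := by
  intro u hu v hv huv
  have hpi := Real.two_pi_pos
  have h1 : ∀ u, γ (toIcoMod hpi 0 u) = γ u := fun u => by
    rw [toIcoMod]; exact h.periodic.sub_zsmul_eq _
  have h2 : toIcoMod hpi 0 u = toIcoMod hpi 0 v := by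
    refine h.injOn ?_ ?_ (by rw [h1, h1, huv])
    · simpa using toIcoMod_mem_Ico hpi 0 u
    · simpa using toIcoMod_mem_Ico hpi 0 v
  rw [← (toIcoMod_eq_self hpi).2 hu, ← (toIcoMod_eq_self hpi).2 hv]
  exact (toIcoMod_inj hpi).2 ((toIcoMod_inj hpi).1 h2)

/-- A smooth lift of the polar angle along the curve. -/
theorem exists_polar (h : IsSymBoundary K γ) : ∃ r α : ℝ → ℝ, (∀ u, 0 < r u) ∧
    (∀ u, HasDerivAt α (areaSpeed γ u / r u ^ 2) u) ∧
    ∀ u, γ u = r u • !₂[Real.cos (α u), Real.sin (α u)] := by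
  set c : ℝ → ℂ := fun u => ⟨γ u 0, γ u 1⟩ with hc
  set c' : ℝ → ℂ := fun u => ⟨deriv γ u 0, deriv γ u 1⟩ with hc'
  have hcoord : ∀ {f : ℝ → Plane}, Continuous f →
      Continuous (fun u => (⟨f u 0, f u 1⟩ : ℂ)) := by
    intro f hf
    refine Complex.equivRealProdCLM.symm.continuous.comp (f := fun u => (f u 0, f u 1)) ?_
    fun_prop
  have hcd : ∀ u, HasDerivAt c (c' u) u := by
    intro u
    have h0 := (hasDerivWithinAt_coord (h.hasDerivAt u).hasDerivWithinAt (s := univ) 0)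
    have h1 := (hasDerivWithinAt_coord (h.hasDerivAt u).hasDerivWithinAt (s := univ) 1)
    rw [hasDerivWithinAt_univ] at h0 h1
    exact Complex.equivRealProdCLM.symm.hasFDerivAt.comp_hasDerivAt u (h0.prodMk h1)
  have hne : ∀ u, c u ≠ 0 := by
    intro u h0
    have h1 := h.counterclockwise u
    have e0 : γ u 0 = 0 := congrArg Complex.re h0
    have e1 : γ u 1 = 0 := congrArg Complex.im h0
    simp [bracket, e0, e1] at h1
  have hcont : Continuous fun u => c' u / c u :=
    (hcoord h.contDiff_deriv.continuous).div (hcoord h.smooth.continuous) hne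
  set l : ℝ → ℂ := fun u => Complex.log (c 0) + ∫ v in (0 : ℝ)..u, c' v / c v with hl
  have hld : ∀ u, HasDerivAt l (c' u / c u) u := fun u =>
    (hcont.integral_hasStrictDerivAt 0 u).hasDerivAt.const_add _
  -- `l` is a lift of `log c`
  have hconst : ∀ u, c u * Complex.exp (-l u) = 1 := by
    intro u
    have hd : ∀ u, HasDerivAt (fun u => c u * Complex.exp (-l u)) 0 u := by
      intro u
      refine ((hcd u).mul (hld u).neg.cexp).congr_deriv ?_
      have := hne u
      field_simp
      ring
    have := is_const_of_deriv_eq_zero (fun u => (hd u).differentiableAt) (fun u => (hd u).deriv) u 0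
    rw [this]
    simp [hl, Complex.exp_neg, Complex.exp_log (hne 0), hne 0]
  have hexp : ∀ u, c u = Complex.exp (l u) := by
    intro u
    have := hconst u
    rw [Complex.exp_neg] at this
    field_simp [Complex.exp_ne_zero] at this
    exact this
  refine ⟨fun u => Real.exp (l u).re, fun u => (l u).im, fun u => Real.exp_pos _, fun u => ?_,
    fun u => ?_⟩
  · refine (Complex.imCLM.hasFDerivAt.comp_hasDerivAt u (hld u)).congr_deriv ?_
    have h1 : Complex.normSq (c u) = Real.exp (l u).re ^ 2 := by
      rw [Complex.normSq_eq_norm_sq, hexp, Complex.norm_exp]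
    simp only [Complex.imCLM_apply, Complex.div_im, h1]
    simp only [hc, hc', areaSpeed, bracket]
    ring
  · have e0 : γ u 0 = _ := congrArg Complex.re (hexp u)
    have e1 : γ u 1 = _ := congrArg Complex.im (hexp u)
    rw [Complex.exp_re] at e0
    rw [Complex.exp_im] at e1
    ext i
    fin_cases i <;> simp [e0, e1]

/-- The antipodal map in the parameter: `γ (τ u) = -γ u`, and the arc from `u` to `τ u` is half of
the curve, seen counterclockwise from `γ u`. -/
theorem exists_antipode (h : IsSymBoundary K γ) : ∃ τ : ℝ → ℝ, (∀ u, u < τ u) ∧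
    (∀ u, τ (τ u) = u + 2 * Real.pi) ∧ (∀ u, γ (τ u) = -γ u) ∧
    (∀ u, HasDerivAt τ (areaSpeed γ u / areaSpeed γ (τ u)) u) ∧
    ∀ u v, u < v → v < τ u → 0 < bracket (γ u) (γ v) := by
  obtain ⟨r, α, hr, hα, hγ⟩ := h.exists_polar
  have hpi := Real.pi_pos
  have hαpos : ∀ u, 0 < areaSpeed γ u / r u ^ 2 := fun u =>
    div_pos (h.areaSpeed_pos u) (pow_pos (hr u) 2)
  have hmono : StrictMono α := strictMono_of_hasDerivAt_pos hα hαpos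
  have hcont : Continuous α := continuous_iff_continuousAt.2 fun u => (hα u).continuousAt
  -- equal angles mod `2π` mean equal points
  have hray : ∀ u v, Real.cos (α v) = Real.cos (α u) → Real.sin (α v) = Real.sin (α u) →
      γ v = γ u := by
    intro u v h1 h2
    have e : γ v = (r v / r u) • γ u := by
      rw [hγ v, hγ u, h1, h2, smul_smul, div_mul_cancel₀ _ (hr u).ne']
    have := h.eq_one_of_smul_mem_frontier (h.mem_frontier u) (div_pos (hr v) (hr u))
      (e ▸ h.mem_frontier v)
    rw [e, this, one_smul]
  -- the curve winds around the origin once: a second turn would contradict injectivity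
  have hturn : ∀ u, α (u + 2 * Real.pi) = α u + 2 * Real.pi := by
    intro u
    have hlt : α u < α (u + 2 * Real.pi) := hmono (by linarith)
    have hle : α (u + 2 * Real.pi) ≤ α u + 2 * Real.pi := by
      by_contra! hcon
      obtain ⟨v, hv, hv'⟩ := intermediate_value_Ioo (by linarith : u ≤ u + 2 * Real.pi)
        hcont.continuousOn ⟨(by linarith : α u < α u + 2 * Real.pi), hcon⟩
      have := h.injOn_Ico u ⟨hv.1.le, hv.2⟩ ⟨le_rfl, by linarith⟩
        (hray u v (by rw [hv', Real.cos_add_two_pi]) (by rw [hv', Real.sin_add_two_pi]))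
      exact hv.1.ne' this
    have hper := h.periodic u
    have hD : Real.cos (α (u + 2 * Real.pi) - α u) = 1 := by
      rw [hγ u, hγ (u + 2 * Real.pi)] at hper
      have h0 := congrArg (fun z : Plane => z 0) hper
      have h1 := congrArg (fun z : Plane => z 1) hper
      simp only [PiLp.smul_apply, smul_eq_mul, Matrix.cons_val_zero, Matrix.cons_val_one] at h0 h1
      have s1 := Real.cos_sq_add_sin_sq (α u)
      have s2 := Real.cos_sq_add_sin_sq (α (u + 2 * Real.pi))
      have hr2 : r (u + 2 * Real.pi) ^ 2 = r u ^ 2 := by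
        calc r (u + 2 * Real.pi) ^ 2
            = (r (u + 2 * Real.pi) * Real.cos (α (u + 2 * Real.pi))) ^ 2 +
              (r (u + 2 * Real.pi) * Real.sin (α (u + 2 * Real.pi))) ^ 2 := by
                linear_combination (-r (u + 2 * Real.pi) ^ 2) * s2
          _ = r u ^ 2 := by rw [h0, h1]; linear_combination r u ^ 2 * s1
      have hr1 := (pow_left_inj₀ (hr _).le (hr u).le two_ne_zero).1 hr2
      rw [hr1] at h0 h1
      rw [mul_left_cancel_iff_of_pos (hr u)] at h0 h1
      rw [Real.cos_sub, h0, h1]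
      linear_combination s1
    obtain ⟨n, hn⟩ := (Real.cos_eq_one_iff _).1 hD
    have hn0 : (0 : ℝ) < n := by
      by_contra! hcon
      nlinarith
    have hn1 : (1 : ℝ) ≤ n := by exact_mod_cast hn0
    nlinarith
  have hsurj : Function.Surjective α := by
    have hper : Function.Periodic (fun u => α u - u) (2 * Real.pi) := by
      intro u; simp only [hturn]; ring
    intro y
    have hN : ∀ n : ℤ, α (n * (2 * Real.pi)) = α 0 + n * (2 * Real.pi) := by
      intro n
      have := hper.int_mul_eq n
      simp only [sub_zero] at this
      linarith
    refine mem_range_of_exists_le_of_exists_ge hcont ?_ ?_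
    · refine ⟨(⌊(y - α 0) / (2 * Real.pi)⌋ : ℤ) * (2 * Real.pi), ?_⟩
      rw [hN]
      have := Int.floor_le ((y - α 0) / (2 * Real.pi))
      rw [le_div_iff₀ (by positivity)] at this
      linarith
    · refine ⟨(⌈(y - α 0) / (2 * Real.pi)⌉ : ℤ) * (2 * Real.pi), ?_⟩
      rw [hN]
      have := Int.le_ceil ((y - α 0) / (2 * Real.pi))
      rw [div_le_iff₀ (by positivity)] at this
      linarith
  set e := hmono.orderIsoOfSurjective α hsurj with he
  have heα : ∀ y, α (e.symm y) = y := fun y => e.apply_symm_apply y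
  set τ : ℝ → ℝ := fun u => e.symm (α u + Real.pi) with hτ
  have hατ : ∀ u, α (τ u) = α u + Real.pi := fun u => heα _
  have hanti : ∀ u, r (τ u) = r u ∧ γ (τ u) = -γ u := by
    intro u
    have e1 : γ (τ u) = (r (τ u) / r u) • (-γ u) := by
      rw [hγ (τ u), hγ u, hατ, Real.cos_add_pi, Real.sin_add_pi, ← smul_neg, smul_smul,
        div_mul_cancel₀ _ (hr u).ne']
      congr 1
      ext i; fin_cases i <;> simp
    have e2 := h.eq_one_of_smul_mem_frontier (h.neg_mem_frontier (h.mem_frontier u))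
      (div_pos (hr (τ u)) (hr u)) (e1 ▸ h.mem_frontier (τ u))
    exact ⟨(div_eq_one_iff_eq (hr u).ne').1 e2, by rw [e1, e2, one_smul]⟩
  refine ⟨τ, fun u => hmono.lt_iff_lt.1 (by rw [hατ]; linarith), fun u => hmono.injective ?_,
    fun u => (hanti u).2, fun u => ?_, fun u v huv hv => ?_⟩
  · rw [hατ, hατ, hturn]; ring
  · have h1 : HasDerivAt e.symm (areaSpeed γ (τ u) / r (τ u) ^ 2)⁻¹ (α u + Real.pi) :=
      HasDerivAt.of_local_left_inverse (f := α) e.symm.continuous.continuousAt (hα (τ u))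
        (hαpos _).ne' (Filter.Eventually.of_forall heα)
    refine (h1.comp u ((hα u).add_const _)).congr_deriv ?_
    rw [(hanti u).1]
    have := (hr u).ne'
    have := (h.areaSpeed_pos (τ u)).ne'
    field_simp
  · have h1 : bracket (γ u) (γ v) = r u * r v * Real.sin (α v - α u) := by
      rw [hγ u, hγ v, Real.sin_sub]
      simp [bracket]; ring
    have h2 := hmono huv
    have h3 := hmono hv
    rw [hατ] at h3
    rw [h1]
    exact mul_pos (mul_pos (hr u) (hr v)) (Real.sin_pos_of_pos_of_lt_pi (by linarith) (by linarith))

/-- At antipodal points the tangents are opposite, and the centro-affine curvatures agree: the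
antipodal map preserves `[γ, γ'] du`, so both follow by differentiating `γ ∘ τ = -γ`. -/
theorem hill_antipode (h : IsSymBoundary K γ) {τ : ℝ → ℝ} (hγ : ∀ u, γ (τ u) = -γ u)
    (hτ : ∀ u, HasDerivAt τ (areaSpeed γ u / areaSpeed γ (τ u)) u) (u : ℝ) :
    (areaSpeed γ (τ u))⁻¹ • deriv γ (τ u) = -((areaSpeed γ u)⁻¹ • deriv γ u) ∧
      centroAffineCurvature γ (τ u) = centroAffineCurvature γ u := by
  have hy : ∀ u, (areaSpeed γ (τ u))⁻¹ • deriv γ (τ u) = -((areaSpeed γ u)⁻¹ • deriv γ u) := by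
    intro u
    have h1 := (h.hasDerivAt (τ u)).scomp u (hτ u)
    have h2 := h1.unique (((h.hasDerivAt u).neg).congr_of_eventuallyEq
      (Filter.Eventually.of_forall hγ))
    rw [← smul_neg, ← h2, smul_smul]
    congr 1
    have := (h.areaSpeed_pos u).ne'
    field_simp
  refine ⟨hy u, ?_⟩
  have h1 := (h.hasDerivAt_hill (τ u)).scomp u (hτ u)
  have h2 := h1.unique ((h.hasDerivAt_hill u).neg.congr_of_eventuallyEq
    (Filter.Eventually.of_forall hy))
  rw [hγ] at h2
  have h3 := congrArg (fun z => bracket z (deriv γ u)) h2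
  simp only [bracket_smul_left, smul_neg, neg_smul, neg_neg] at h3
  have hD := (h.areaSpeed_pos u).ne'
  have hD' := (h.areaSpeed_pos (τ u)).ne'
  change _ * (_ * areaSpeed γ u) = _ * areaSpeed γ u at h3
  field_simp at h3
  exact h3

end IsSymBoundary

/-! ### The area enclosed by the curve -/

/-- The plane as a product of two lines, preserving the Lebesgue measure. -/
noncomputable def planeEquivProd : Plane ≃ᵐ ℝ × ℝ :=
  (MeasurableEquiv.toLp 2 (Fin 2 → ℝ)).symm.trans MeasurableEquiv.finTwoArrow

theorem planeEquivProd_apply (y : Plane) : planeEquivProd y = (y 0, y 1) := rfl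

theorem measurePreserving_planeEquivProd : MeasurePreserving planeEquivProd :=
  (volume_preserving_finTwoArrow ℝ).comp
    (EuclideanSpace.volume_preserving_symm_measurableEquiv_toLp (Fin 2))

namespace IsSymBoundary

variable {K : ConvexBody Plane} {γ : ℝ → Plane}

/-- The derivative of `(r, u) ↦ r • γ u` in coordinates; its determinant is `r` times the area
speed. -/
theorem exists_hasFDerivAt_cone (h : IsSymBoundary K γ) (q : ℝ × ℝ) :
    ∃ L : ℝ × ℝ →L[ℝ] ℝ × ℝ,
      HasFDerivAt (fun q : ℝ × ℝ => (q.1 * γ q.2 0, q.1 * γ q.2 1)) L q ∧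
        L.det = q.1 * areaSpeed γ q.2 := by
  have hc : ∀ i, HasFDerivAt (fun q : ℝ × ℝ => q.1 * γ q.2 i) _ q := fun i => by
    have h1 := hasDerivWithinAt_coord (h.hasDerivAt q.2).hasDerivWithinAt (s := univ) i
    rw [hasDerivWithinAt_univ] at h1
    exact (hasFDerivAt_fst (p := q)).mul (h1.hasFDerivAt.comp q hasFDerivAt_snd)
  refine ⟨_, (hc 0).prodMk (hc 1), ?_⟩
  rw [ContinuousLinearMap.det, ← LinearMap.det_toMatrix (Module.Basis.finTwoProd ℝ),
    Matrix.det_fin_two]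
  simp [LinearMap.toMatrix_apply, areaSpeed, bracket]
  ring

/-- The cone map `(r, u) ↦ r • γ u` covers the interior of the body, except the origin. -/
theorem exists_eq_smul (h : IsSymBoundary K γ) {y : Plane}
    (hy : y ∈ interior (K : Set Plane)) (hy0 : y ≠ 0) :
    ∃ r ∈ Ioo (0 : ℝ) 1, ∃ u ∈ Ico (0 : ℝ) (2 * Real.pi), y = r • γ u := by
  have hpi := Real.two_pi_pos
  -- the ray through `y` leaves the bounded set `K`, hence crosses its frontier
  obtain ⟨c, hc0, hc⟩ : ∃ c : ℝ, 0 ≤ c ∧ c • y ∈ frontier (K : Set Plane) := by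
    by_contra! hcon
    have hcl : IsClosed {c : ℝ | c • y ∈ (K : Set Plane)} :=
      K.isCompact.isClosed.preimage (by fun_prop)
    have hop : IsOpen {c : ℝ | c • y ∈ interior (K : Set Plane)} :=
      isOpen_interior.preimage (by fun_prop)
    have hsub : Ici (0 : ℝ) ⊆ {c : ℝ | c • y ∈ interior (K : Set Plane)} := by
      refine isPreconnected_Ici.subset_of_closure_inter_subset hop ⟨0, by simp, ?_⟩ ?_
      · simpa using h.zero_mem_interior
      · rintro c ⟨hc1, hc2⟩
        have hsub' : {c : ℝ | c • y ∈ interior (K : Set Plane)} ⊆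
            {c : ℝ | c • y ∈ (K : Set Plane)} := fun _ h => interior_subset (s := (K : Set Plane)) h
        have hcK : c • y ∈ (K : Set Plane) := closure_minimal hsub' hcl hc1
        by_contra hcon'
        exact hcon c hc2 ⟨subset_closure hcK, hcon'⟩
    obtain ⟨R, hR⟩ := K.isCompact.isBounded.exists_norm_le
    have hyn : 0 < ‖y‖ := norm_pos_iff.2 hy0
    have h1 := hR _ (interior_subset (hsub (show (0 : ℝ) ≤ (|R| + 1) / ‖y‖ by positivity)))
    rw [norm_smul, Real.norm_eq_abs, abs_of_nonneg (by positivity), div_mul_cancel₀ _ hyn.ne'] at h1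
    linarith [le_abs_self R]
  have hc1 : 1 < c := by
    by_contra! hcon
    rcases hcon.lt_or_eq with h1 | h1
    · exact hc.2 (h.smul_mem_interior (interior_subset hy) hc0 h1)
    · rw [h1, one_smul] at hc; exact hc.2 hy
  rw [← h.range_eq] at hc
  obtain ⟨v, hv⟩ := hc
  obtain ⟨u, hu, huv⟩ := h.periodic.exists_mem_Ico₀ hpi v
  refine ⟨c⁻¹, ⟨by positivity, inv_lt_one_of_one_lt₀ hc1⟩, u, hu, ?_⟩
  rw [← huv, hv, smul_smul, inv_mul_cancel₀ (by positivity), one_smul]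

theorem ne_zero (h : IsSymBoundary K γ) (u : ℝ) : γ u ≠ 0 := by
  intro h0
  have := h.counterclockwise u
  simp [h0, bracket] at this

theorem area_eq (h : IsSymBoundary K γ) :
    2 * area K = ∫ u in (0 : ℝ)..(2 * Real.pi), areaSpeed γ u := by
  have hpi := Real.two_pi_pos
  set Φ : ℝ × ℝ → ℝ × ℝ := fun q => (q.1 * γ q.2 0, q.1 * γ q.2 1) with hΦ
  have hΦe : ∀ q : ℝ × ℝ, Φ q = planeEquivProd (q.1 • γ q.2) := fun q => by
    simp [hΦ, planeEquivProd_apply]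
  set s : Set (ℝ × ℝ) := Ioo 0 1 ×ˢ Ico 0 (2 * Real.pi) with hs
  choose L hL hdet using h.exists_hasFDerivAt_cone
  have hinj : InjOn Φ s := by
    rintro ⟨r, u⟩ ⟨hr, hu⟩ ⟨r', u'⟩ ⟨hr', hu'⟩ heq
    simp only at hr hu hr' hu'
    rw [hΦe, hΦe] at heq
    have e1 : r • γ u = r' • γ u' := planeEquivProd.injective heq
    have e2 : γ u = (r' / r) • γ u' := by
      rw [div_eq_inv_mul, ← smul_smul, ← e1, smul_smul, inv_mul_cancel₀ hr.1.ne', one_smul]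
    have e3 := h.eq_one_of_smul_mem_frontier (h.mem_frontier u') (div_pos hr'.1 hr.1)
      (e2 ▸ h.mem_frontier u)
    rw [e3, one_smul] at e2
    rw [h.injOn hu hu' e2, (div_eq_one_iff_eq hr.1.ne').1 e3]
  have himage : planeEquivProd ⁻¹' (Φ '' s) = interior (K : Set Plane) \ {0} := by
    ext y
    simp only [mem_preimage, mem_image, hΦe, planeEquivProd.injective.eq_iff, mem_sdiff,
      mem_singleton_iff]
    constructor
    · rintro ⟨⟨r, u⟩, ⟨hr, hu⟩, rfl⟩
      exact ⟨h.smul_mem_interior (h.mem u) hr.1.le hr.2, smul_ne_zero hr.1.ne' (h.ne_zero u)⟩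
    · rintro ⟨hy, hy0⟩
      obtain ⟨r, hr, u, hu, rfl⟩ := h.exists_eq_smul hy hy0
      exact ⟨(r, u), ⟨hr, hu⟩, rfl⟩
  have hvol : volume (K : Set Plane) = volume (Φ '' s) := by
    rw [← measurePreserving_planeEquivProd.measure_preimage_equiv, himage,
      measure_sdiff_null (by simp)]
    exact (measure_congr (interior_ae_eq_of_null_frontier (K.convex.addHaar_frontier volume))).symm
  have hmain := integral_image_eq_integral_abs_det_fderiv_smul volume
    (measurableSet_Ioo.prod measurableSet_Ico) (fun q _ => (hL q).hasFDerivWithinAt) hinj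
    (fun _ => (1 : ℝ))
  have h2 : area K = ∫ q in s, q.1 * areaSpeed γ q.2 := by
    rw [area, hvol]
    refine Eq.trans ?_ (hmain.trans ?_)
    · simp [Measure.real, hΦ]
    · refine setIntegral_congr_fun (measurableSet_Ioo.prod measurableSet_Ico) fun q hq => ?_
      simp only [hdet, smul_eq_mul, mul_one]
      exact abs_of_pos (mul_pos hq.1.1 (h.areaSpeed_pos _))
  rw [h2, hs, Measure.volume_eq_prod, setIntegral_prod_mul (fun r : ℝ => r) (areaSpeed γ),
    ← integral_Ioc_eq_integral_Ioo, integral_Ico_eq_integral_Ioc,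
    ← intervalIntegral.integral_of_le zero_le_one, ← intervalIntegral.integral_of_le hpi.le,
    integral_id]
  ring

end IsSymBoundary

/-! ### Wirtinger and Cauchy-Schwarz inequalities on the curve -/

/-- Near a common zero of `g` and `w`, with `w` vanishing to first order only, `g² / w` is
continuous. The junk value `0 / 0 = 0` is the limit. -/
theorem continuousAt_sq_div {g w : ℝ → ℝ} {e g' w' : ℝ} (hg : HasDerivAt g g' e)
    (hw : HasDerivAt w w' e) (hw' : w' ≠ 0) (hge : g e = 0) (hwe : w e = 0) :
    ContinuousAt (fun u => g u ^ 2 / w u) e := by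
  have hslope : ∀ {f : ℝ → ℝ}, f e = 0 → ∀ u, f u = (u - e) * dslope f e u := by
    intro f hf u
    have := sub_smul_dslope f e u
    rw [hf, sub_zero, smul_eq_mul] at this
    exact this.symm
  have heq : (fun u => g u ^ 2 / w u) =
      fun u => (u - e) * dslope g e u ^ 2 / dslope w e u := by
    funext u
    rw [hslope hge u, hslope hwe u]
    by_cases hu : u - e = 0
    · simp [hu]
    · rw [mul_pow, sq (u - e), mul_assoc, mul_div_mul_left _ _ hu]
  have hgc := continuousAt_dslope_same.2 hg.differentiableAt
  have hwc := continuousAt_dslope_same.2 hw.differentiableAt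
  rw [heq]
  refine ContinuousAt.div (by fun_prop) hwc ?_
  rw [dslope_same, hw.deriv]
  exact hw'

namespace IsSymBoundary

variable {K : ConvexBody Plane} {γ : ℝ → Plane}

theorem bracket_smul_deriv_self (h : IsSymBoundary K γ) (u : ℝ) :
    bracket (γ u) ((areaSpeed γ u)⁻¹ • deriv γ u) = 1 := by
  rw [bracket_smul_right]
  exact inv_mul_cancel₀ (h.areaSpeed_pos u).ne'

/-- Wirtinger's inequality with Dirichlet boundary values on half of the curve, from a point to its
antipode. The tangent at the first endpoint gives a solution `w = [y₀, y]`, `y = γ' / [γ, γ']`, of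
the Euler-Lagrange equation of the difference of the two sides, which vanishes at the endpoints
only; so the difference is a boundary term plus the integral of a square. -/
theorem wirtinger_half (h : IsSymBoundary K γ) {a b : ℝ} (hab : a < b) (hγb : γ b = -γ a)
    (hyb : (areaSpeed γ b)⁻¹ • deriv γ b = -((areaSpeed γ a)⁻¹ • deriv γ a))
    (hpos : ∀ v ∈ Ioo a b, 0 < bracket (γ a) (γ v)) {g : ℝ → ℝ} (hg : ContDiff ℝ 1 g)
    (hga : g a = 0) (hgb : g b = 0) :
    ∫ u in a..b, g u ^ 2 * areaSpeed γ u ≤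
      ∫ u in a..b, deriv g u ^ 2 / (centroAffineCurvature γ u * areaSpeed γ u) := by
  set D := areaSpeed γ with hD
  set k := centroAffineCurvature γ with hk
  have hDpos : ∀ u, 0 < D u := h.areaSpeed_pos
  have hkpos : ∀ u, 0 < k u := h.centroAffineCurvature_pos
  set y₀ := (D a)⁻¹ • deriv γ a with hy₀
  set w : ℝ → ℝ := fun u => bracket y₀ ((D u)⁻¹ • deriv γ u) with hw
  set z : ℝ → ℝ := fun u => bracket (γ u) y₀ with hz
  have hwd : ∀ u, HasDerivAt w (D u * k u * z u) u := fun u => by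
    refine (hasDerivAt_bracket (hasDerivAt_const u y₀) (h.hasDerivAt_hill u)).congr_deriv ?_
    simp only [hz, bracket]
    simp
    ring
  have hzd : ∀ u, HasDerivAt z (-(D u * w u)) u := fun u => by
    refine (hasDerivAt_bracket (h.hasDerivAt u) (hasDerivAt_const u y₀)).congr_deriv ?_
    have := (hDpos u).ne'
    simp only [hw, bracket_smul_right]
    rw [← mul_assoc, mul_inv_cancel₀ this]
    simp [bracket]
    ring
  have hza : z a = 1 := h.bracket_smul_deriv_self a
  have hzb : z b = -1 := by simp only [hz, hγb, bracket_neg_left]; rw [← hza]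
  have hwa : w a = 0 := bracket_self _
  have hwb : w b = 0 := by simp only [hw, hyb, bracket_neg_right, bracket_self, neg_zero]
  -- `w' = D k z`, and the sign of `z` changes only once because `z / [γ a, γ]` decreases
  have hanti : StrictAntiOn (fun u => z u / bracket (γ a) (γ u)) (Ioo a b) := by
    have hd : ∀ u ∈ Ioo a b, HasDerivAt (fun u => z u / bracket (γ a) (γ u))
        (-D u / bracket (γ a) (γ u) ^ 2) u := fun u hu => by
      refine ((hzd u).div (hasDerivAt_bracket (hasDerivAt_const u (γ a)) (h.hasDerivAt u))
        (hpos u hu).ne').congr_deriv ?_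
      congr 1
      have e1 : D u * w u = bracket y₀ (deriv γ u) := by
        have := (hDpos u).ne'
        simp only [hw, bracket_smul_right]
        rw [← mul_assoc, mul_inv_cancel₀ this, one_mul]
      rw [e1]
      have e2 : D u = bracket (γ u) (deriv γ u) * bracket (γ a) y₀ := by
        rw [show bracket (γ a) y₀ = 1 from hza, mul_one]; rfl
      rw [e2]
      simp only [hz, bracket]
      simp
      ring
    refine strictAntiOn_of_deriv_neg (convex_Ioo a b)
      (fun u hu => (hd u hu).continuousAt.continuousWithinAt) fun u hu => ?_
    rw [interior_Ioo] at hu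
    rw [(hd u hu).deriv]
    exact div_neg_of_neg_of_pos (neg_neg_of_pos (hDpos u)) (pow_pos (hpos u hu) 2)
  have hwc : Continuous w := continuous_iff_continuousAt.2 fun u => (hwd u).continuousAt
  -- a nonpositive value of `w` would force `z` to change from `≤ 0` to `≥ 0`
  have hwpos : ∀ u ∈ Ioo a b, 0 < w u := by
    intro u hu
    by_contra! hcon
    obtain ⟨ξ, hξ, hξ'⟩ := exists_hasDerivAt_eq_slope w _ hu.1 hwc.continuousOn
      fun v _ => hwd v
    obtain ⟨η, hη, hη'⟩ := exists_hasDerivAt_eq_slope w _ hu.2 hwc.continuousOn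
      fun v _ => hwd v
    have h1 : D ξ * k ξ * z ξ ≤ 0 := by
      rw [hξ', hwa]
      exact div_nonpos_of_nonpos_of_nonneg (by linarith) (by linarith [hu.1])
    have h2 : 0 ≤ D η * k η * z η := by
      rw [hη', hwb]
      exact div_nonneg (by linarith) (by linarith [hu.2])
    have h1' : z ξ ≤ 0 := by
      by_contra! hc
      exact absurd (mul_pos (mul_pos (hDpos ξ) (hkpos ξ)) hc) h1.not_gt
    have h2' : 0 ≤ z η := nonneg_of_mul_nonneg_right h2 (mul_pos (hDpos η) (hkpos η))
    have hξm : ξ ∈ Ioo a b := ⟨hξ.1, hξ.2.trans hu.2⟩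
    have hηm : η ∈ Ioo a b := ⟨hu.1.trans hη.1, hη.2⟩
    have h3 := hanti hξm hηm (hξ.2.trans hη.1)
    have h4 := div_nonpos_of_nonpos_of_nonneg h1' (hpos ξ hξm).le
    have h5 := div_nonneg h2' (hpos η hηm).le
    linarith
  have hgd : ∀ u, HasDerivAt g (deriv g u) u := fun u =>
    (hg.differentiable (by simp) u).hasDerivAt
  have hg' : Continuous (deriv g) := hg.continuous_deriv (by simp)
  have hDc : Continuous D := h.continuous_areaSpeed
  have hkc : Continuous k := h.contDiff_centroAffineCurvature.continuous
  have hi1 : Continuous fun u => g u ^ 2 * D u := (hg.continuous.pow 2).mul hDc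
  have hi2 : Continuous fun u => deriv g u ^ 2 / (k u * D u) :=
    (hg'.pow 2).div (hkc.mul hDc) fun u => (mul_pos (hkpos u) (hDpos u)).ne'
  -- Jacobi's completion of the square: `G' ≤ (g')² / (k D) - g² D`, with `G` zero at both ends
  set G : ℝ → ℝ := fun u => g u ^ 2 / w u * z u with hG
  have hGc : ContinuousOn G (Icc a b) := by
    intro u hu
    refine ContinuousAt.continuousWithinAt (ContinuousAt.mul ?_ (hzd u).continuousAt)
    rcases eq_or_ne u a with rfl | hua
    · refine continuousAt_sq_div (hgd _) (hwd _) ?_ hga hwa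
      rw [hza, mul_one]; exact (mul_pos (hDpos _) (hkpos _)).ne'
    rcases eq_or_ne u b with rfl | hub
    · refine continuousAt_sq_div (hgd _) (hwd _) ?_ hgb hwb
      rw [hzb, mul_neg, mul_one, neg_ne_zero]; exact (mul_pos (hDpos _) (hkpos _)).ne'
    · exact (hg.continuous.continuousAt.pow 2).div hwc.continuousAt
        (hwpos u ⟨lt_of_le_of_ne hu.1 hua.symm, lt_of_le_of_ne hu.2 hub⟩).ne'
  have hGd : ∀ u ∈ Ioo a b, HasDerivAt G (2 * g u * deriv g u * (z u / w u) - g u ^ 2 * D u -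
      D u * k u * g u ^ 2 * (z u / w u) ^ 2) u := fun u hu => by
    have hwu := (hwpos u hu).ne'
    refine ((((hgd u).pow 2).div (hwd u) hwu).mul (hzd u)).congr_deriv ?_
    simp only [Pi.div_apply, Pi.pow_apply]
    field_simp
    push_cast
    ring
  have hle := intervalIntegral.sub_le_integral_of_hasDeriv_right_of_le hab.le hGc
    (fun u hu => (hGd u hu).hasDerivWithinAt)
    (φ := fun u => deriv g u ^ 2 / (k u * D u) - g u ^ 2 * D u)
    ((hi2.sub hi1).continuousOn.integrableOn_Icc) fun u hu => by
      have h1 := hkpos u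
      have h2 := hDpos u
      have h3 : deriv g u ^ 2 / (k u * D u) - g u ^ 2 * D u -
          (2 * g u * deriv g u * (z u / w u) - g u ^ 2 * D u -
            D u * k u * g u ^ 2 * (z u / w u) ^ 2) =
          (deriv g u - k u * D u * g u * (z u / w u)) ^ 2 / (k u * D u) := by
        have := (hwpos u hu).ne'
        field_simp
        ring
      have h4 : 0 ≤ (deriv g u - k u * D u * g u * (z u / w u)) ^ 2 / (k u * D u) := by positivity
      linarith
  rw [intervalIntegral.integral_sub (hi2.intervalIntegrable _ _)
    (hi1.intervalIntegrable _ _)] at hle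
  have hG0 : G b - G a = 0 := by simp [hG, hga, hgb]
  linarith

theorem integral_sub_const_sq (h : IsSymBoundary K γ) {f : ℝ → ℝ} (hf : Continuous f) (c : ℝ) :
    ∫ u in (0 : ℝ)..(2 * Real.pi), (f u - c) ^ 2 * areaSpeed γ u =
      (∫ u in (0 : ℝ)..(2 * Real.pi), f u ^ 2 * areaSpeed γ u) -
        2 * c * (∫ u in (0 : ℝ)..(2 * Real.pi), f u * areaSpeed γ u) + c ^ 2 * (2 * area K) := by
  have hD := h.continuous_areaSpeed
  rw [h.area_eq, ← intervalIntegral.integral_const_mul, ← intervalIntegral.integral_const_mul,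
    ← intervalIntegral.integral_sub, ← intervalIntegral.integral_add]
  · exact intervalIntegral.integral_congr fun u _ => by ring
  all_goals exact Continuous.intervalIntegrable (by fun_prop) _ _

theorem area_pos (h : IsSymBoundary K γ) : 0 < area K := by
  have h1 : 0 < ∫ u in (0 : ℝ)..(2 * Real.pi), areaSpeed γ u :=
    intervalIntegral.intervalIntegral_pos_of_pos_on (h.continuous_areaSpeed.intervalIntegrable _ _)
      (fun u _ => h.areaSpeed_pos u) Real.two_pi_pos
  rw [← h.area_eq] at h1
  linarith

/-- The Cauchy-Schwarz inequality for the measure `[γ, γ'] du`, of total mass twice the area. -/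
theorem sq_integral_le (h : IsSymBoundary K γ) {f : ℝ → ℝ} (hf : Continuous f) :
    (∫ u in (0 : ℝ)..(2 * Real.pi), f u * areaSpeed γ u) ^ 2 / (2 * area K) ≤
      ∫ u in (0 : ℝ)..(2 * Real.pi), f u ^ 2 * areaSpeed γ u := by
  have hA := h.area_pos
  set Ω := ∫ u in (0 : ℝ)..(2 * Real.pi), f u * areaSpeed γ u with hΩ
  have h1 := h.integral_sub_const_sq hf (Ω / (2 * area K))
  have h2 : 0 ≤ ∫ u in (0 : ℝ)..(2 * Real.pi), (f u - Ω / (2 * area K)) ^ 2 * areaSpeed γ u :=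
    intervalIntegral.integral_nonneg Real.two_pi_pos.le
      fun u _ => mul_nonneg (sq_nonneg _) (h.areaSpeed_pos u).le
  rw [h1, ← hΩ] at h2
  have h3 : Ω ^ 2 / (2 * area K) =
      2 * (Ω / (2 * area K)) * Ω - (Ω / (2 * area K)) ^ 2 * (2 * area K) := by
    field_simp; ring
  linarith

/-- Minkowski's inequality for a symmetric perturbation of the support function, written as a
Wirtinger inequality with weights on the curve. After subtracting its value at one point, and hence
at the antipode, the function vanishes at the ends of two half curves. -/
theorem wirtinger (h : IsSymBoundary K γ) (a : ℝ) :
    (∫ u in (0 : ℝ)..(2 * Real.pi), (centroAffineCurvature γ u ^ a) ^ 2 * areaSpeed γ u) -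
        (∫ u in (0 : ℝ)..(2 * Real.pi), centroAffineCurvature γ u ^ a * areaSpeed γ u) ^ 2 /
          (2 * area K) ≤
      ∫ u in (0 : ℝ)..(2 * Real.pi), deriv (fun v => centroAffineCurvature γ v ^ a) u ^ 2 /
        (centroAffineCurvature γ u * areaSpeed γ u) := by
  obtain ⟨τ, hτlt, hττ, hγτ, hτd, hτpos⟩ := h.exists_antipode
  set f : ℝ → ℝ := fun v => centroAffineCurvature γ v ^ a with hf
  set c := f 0 with hc
  set g : ℝ → ℝ := fun u => f u - c with hg
  have hfs : ContDiff ℝ ∞ f := h.contDiff_rpow a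
  have hgs : ContDiff ℝ 1 g := (hfs.sub contDiff_const).of_le (by simp)
  have hg' : deriv g = deriv f := by funext u; simp [hg]
  have hgτ : ∀ u, g (τ u) = g u := fun u => by
    simp only [hg, hf, (h.hill_antipode hγτ hτd u).2]
  have hg0 : g 0 = 0 := by simp [hg, hc]
  have hhalf : ∀ u, g u = 0 → _ := fun u hu => h.wirtinger_half (hτlt u) (hγτ u)
    (h.hill_antipode hγτ hτd u).1 (fun v hv => hτpos u v hv.1 hv.2) hgs hu ((hgτ u).trans hu)
  have h1 := hhalf 0 hg0
  have h2 := hhalf (τ 0) ((hgτ 0).trans hg0)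
  rw [hττ, zero_add] at h2
  have hi1 : Continuous fun u => g u ^ 2 * areaSpeed γ u :=
    (hgs.continuous.pow 2).mul h.continuous_areaSpeed
  have hi2 : Continuous fun u => deriv g u ^ 2 / (centroAffineCurvature γ u * areaSpeed γ u) :=
    ((hgs.continuous_deriv (by simp)).pow 2).div
      (h.contDiff_centroAffineCurvature.continuous.mul h.continuous_areaSpeed)
      fun u => (mul_pos (h.centroAffineCurvature_pos u) (h.areaSpeed_pos u)).ne'
  have h3 := add_le_add h1 h2
  rw [intervalIntegral.integral_add_adjacent_intervals (hi1.intervalIntegrable _ _)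
    (hi1.intervalIntegrable _ _), intervalIntegral.integral_add_adjacent_intervals
    (hi2.intervalIntegrable _ _) (hi2.intervalIntegrable _ _), hg',
    h.integral_sub_const_sq hfs.continuous] at h3
  set Ω := ∫ u in (0 : ℝ)..(2 * Real.pi), f u * areaSpeed γ u
  have hA := h.area_pos
  -- `∫ (f - c)² D` is at least the variance, which is its value at the mean of `f`
  have h4 : 0 ≤ (Ω - c * (2 * area K)) ^ 2 / (2 * area K) := by positivity
  have h5 : (Ω - c * (2 * area K)) ^ 2 / (2 * area K) =
      Ω ^ 2 / (2 * area K) - 2 * c * Ω + c ^ 2 * (2 * area K) := by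
    field_simp; ring
  linarith

end IsSymBoundary

/-! ### First variation of the affine length at a fixed time -/

theorem eq_smul_add_smul_of_bracket (v γ γ' : Plane) {D : ℝ} (hD : bracket γ γ' = D)
    (hD0 : D ≠ 0) : v = (bracket v γ' / D) • γ + (bracket γ v / D) • γ' := by
  subst hD
  ext i
  fin_cases i <;>
  · simp
    field_simp
    simp only [bracket]
    ring

/-- The rate of change of the integrand `φ [γ, γ']`, `φ = κ₀^a`, of the affine length when the curve
moves with velocity `V`. -/
noncomputable def lengthRate (a : ℝ) (γ V : ℝ → Plane) (u : ℝ) : ℝ :=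
  let D' := bracket (V u) (deriv γ u) + bracket (γ u) (deriv V u)
  let B' := bracket (deriv V u) (deriv (deriv γ) u) + bracket (deriv γ u) (deriv (deriv V) u)
  let k := centroAffineCurvature γ u
  k ^ a * D' + a * k ^ (a - 1) * (B' / areaSpeed γ u ^ 3 - 3 * k * D' / areaSpeed γ u) *
    areaSpeed γ u

namespace IsSymBoundary

variable {K : ConvexBody Plane} {γ : ℝ → Plane}

/-- Up to the derivative of a periodic function, which takes in the tangential motion and an
integration by parts, the rate of change of the integrand of the affine length only involves
`κ₀` and its first derivative. -/
theorem hasDerivAt_lengthRate_primitive (h : IsSymBoundary K γ) {a : ℝ}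
    {V : ℝ → Plane} (hV : ContDiff ℝ ∞ V)
    (hVn : ∀ u, bracket (V u) (deriv γ u) = -(centroAffineCurvature γ u ^ a * areaSpeed γ u))
    (u : ℝ) :
    HasDerivAt (fun v => bracket (γ v) (V v) * centroAffineCurvature γ v ^ a +
        a * (centroAffineCurvature γ v ^ a * deriv (fun v => centroAffineCurvature γ v ^ a) v /
          (centroAffineCurvature γ v * areaSpeed γ v)))
      (lengthRate a γ V u - ((4 * a - 2) * ((centroAffineCurvature γ u ^ a) ^ 2 * areaSpeed γ u) +
        (1 - a) * (deriv (fun v => centroAffineCurvature γ v ^ a) u ^ 2 /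
          (centroAffineCurvature γ u * areaSpeed γ u)))) u := by
  set k := centroAffineCurvature γ with hk
  set D := areaSpeed γ with hD
  set φ : ℝ → ℝ := fun v => k v ^ a with hφ
  set ψ : ℝ → ℝ := fun v => bracket (γ v) (V v) / D v with hψ
  have hDpos : ∀ u, 0 < D u := h.areaSpeed_pos
  have hkpos : ∀ u, 0 < k u := h.centroAffineCurvature_pos
  have hDs : ContDiff ℝ ∞ D := h.contDiff_areaSpeed
  have hks : ContDiff ℝ ∞ k := h.contDiff_centroAffineCurvature
  have hφs : ContDiff ℝ ∞ φ := h.contDiff_rpow a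
  have hψs : ContDiff ℝ ∞ ψ := (contDiff_bracket h.smooth hV).div hDs fun v => (hDpos v).ne'
  have hd : ∀ {E : Type} [NormedAddCommGroup E] [NormedSpace ℝ E] {f : ℝ → E},
      ContDiff ℝ ∞ f → ∀ v, HasDerivAt f (deriv f v) v := fun hf v =>
    (hf.differentiable (by simp) v).hasDerivAt
  have hs : ∀ {E : Type} [NormedAddCommGroup E] [NormedSpace ℝ E] {f : ℝ → E},
      ContDiff ℝ ∞ f → ContDiff ℝ ∞ (deriv f) := fun hf => (contDiff_infty_iff_deriv.1 hf).2
  have hγ0 := hd h.smooth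
  have hγ1 := hd h.contDiff_deriv
  have hγ2 := hd h.contDiff_deriv_deriv
  -- the velocity in the moving frame `γ, γ'`
  have hVeq : V = fun v => -φ v • γ v + ψ v • deriv γ v := by
    funext v
    have := eq_smul_add_smul_of_bracket (V v) (γ v) (deriv γ v) (D := D v) rfl (hDpos v).ne'
    rwa [hVn, neg_div, mul_div_cancel_right₀ _ (hDpos v).ne'] at this
  have hV1 : deriv V = fun v => -φ v • deriv γ v + -deriv φ v • γ v +
      (ψ v • deriv (deriv γ) v + deriv ψ v • deriv γ v) := by
    funext v
    conv_lhs => rw [hVeq]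
    exact (((hd hφs v).neg.smul (hγ0 v)).add ((hd hψs v).smul (hγ1 v))).deriv
  have hV2 : deriv (deriv V) u = (-φ u • deriv (deriv γ) u + -deriv φ u • deriv γ u) +
      (-deriv φ u • deriv γ u + -deriv (deriv φ) u • γ u) +
      ((ψ u • deriv (deriv (deriv γ)) u + deriv ψ u • deriv (deriv γ) u) +
        (deriv ψ u • deriv (deriv γ) u + deriv (deriv ψ) u • deriv γ u)) := by
    conv_lhs => rw [hV1]
    exact ((((hd hφs u).neg.smul (hγ1 u)).add ((hd (hs hφs) u).neg.smul (hγ0 u))).add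
      (((hd hψs u).smul (hγ2 u)).add ((hd (hs hψs) u).smul (hγ1 u)))).deriv
  have hD1 : deriv D u = bracket (γ u) (deriv (deriv γ) u) := (h.hasDerivAt_areaSpeed u).deriv
  have hB : bracket (deriv γ u) (deriv (deriv γ) u) = k u * D u ^ 3 := h.bracket_deriv_eq u
  have hB1 : bracket (deriv γ u) (deriv (deriv (deriv γ)) u) =
      deriv k u * D u ^ 3 + k u * (3 * D u ^ 2 * deriv D u) := by
    have h1 := hasDerivAt_bracket (hγ1 u) (hγ2 u)
    rw [bracket_self, zero_add] at h1
    have h2 := (hd hks u).mul ((hd hDs u).pow 3)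
    have h3 := h1.unique (h2.congr_of_eventuallyEq (Filter.Eventually.of_forall h.bracket_deriv_eq))
    rw [h3]
    simp
  have hDt : bracket (V u) (deriv γ u) + bracket (γ u) (deriv V u) =
      -2 * φ u * D u + deriv ψ u * D u + ψ u * deriv D u := by
    rw [hD1, hV1, hVeq]
    simp only [hD, areaSpeed, bracket]
    simp
    ring
  have hBt : bracket (deriv V u) (deriv (deriv γ) u) + bracket (deriv γ u) (deriv (deriv V) u) =
      -deriv φ u * deriv D u - 2 * φ u * (k u * D u ^ 3) + deriv (deriv φ) u * D u +
        3 * deriv ψ u * (k u * D u ^ 3) +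
        ψ u * (deriv k u * D u ^ 3 + k u * (3 * D u ^ 2 * deriv D u)) := by
    rw [← hB1, ← hB, hD1, hV2, hV1]
    simp only [hD, areaSpeed, bracket]
    simp
    ring
  have hφ1 : deriv φ u = deriv k u * a * (φ u / k u) := by
    have h1 := ((hd hks u).rpow_const (p := a) (Or.inl (hkpos u).ne')).deriv
    rw [Real.rpow_sub_one (hkpos u).ne'] at h1
    exact h1
  have hfun : (fun v => bracket (γ v) (V v) * k v ^ a +
      a * (k v ^ a * deriv φ v / (k v * D v))) =
      fun v => ψ v * D v * φ v + a * (φ v * deriv φ v / (k v * D v)) := by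
    funext v
    simp only [hψ, hφ]
    rw [div_mul_cancel₀ _ (hDpos v).ne']
  rw [hfun]
  have hk0 := (hkpos u).ne'
  have hD0 := (hDpos u).ne'
  refine ((((hd hψs u).mul (hd hDs u)).mul (hd hφs u)).add
    (HasDerivAt.const_mul a ((((hd hφs u).mul (hd (hs hφs) u)).div
      ((hd hks u).mul (hd hDs u)) (mul_ne_zero hk0 hD0))))).congr_deriv ?_
  simp only [lengthRate, hDt, hBt, ← hk, ← hD, Real.rpow_sub_one hk0, Pi.mul_apply]
  change _ = φ u * _ + a * (φ u / k u) * _ * _ - ((4 * a - 2) * (φ u ^ 2 * D u) + _)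
  rw [hφ1]
  field_simp
  ring

theorem continuous_lengthRate (h : IsSymBoundary K γ) (a : ℝ) {V : ℝ → Plane}
    (hV : ContDiff ℝ ∞ V) : Continuous (lengthRate a γ V) := by
  have hV1 : ContDiff ℝ ∞ (deriv V) := (contDiff_infty_iff_deriv.1 hV).2
  have hV2 : ContDiff ℝ ∞ (deriv (deriv V)) := (contDiff_infty_iff_deriv.1 hV1).2
  have c1 := (contDiff_bracket hV h.contDiff_deriv).continuous
  have c2 := (contDiff_bracket h.smooth hV1).continuous
  have c3 := (contDiff_bracket hV1 h.contDiff_deriv_deriv).continuous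
  have c4 := (contDiff_bracket h.contDiff_deriv hV2).continuous
  have c5 := (h.contDiff_rpow a).continuous
  have c6 := (h.contDiff_rpow (a - 1)).continuous
  have c7 := h.contDiff_centroAffineCurvature.continuous
  have c8 := h.continuous_areaSpeed
  unfold lengthRate
  refine (c5.mul (c1.add c2)).add (((continuous_const.mul c6).mul
    (((c3.add c4).div (c8.pow 3) fun u => (pow_pos (h.areaSpeed_pos u) 3).ne').sub
      (((continuous_const.mul c7).mul (c1.add c2)).div c8
        fun u => (h.areaSpeed_pos u).ne'))).mul c8)

theorem integral_lengthRate (h : IsSymBoundary K γ) {a : ℝ}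
    {V : ℝ → Plane} (hV : ContDiff ℝ ∞ V) (hVp : Function.Periodic V (2 * Real.pi))
    (hVn : ∀ u, bracket (V u) (deriv γ u) = -(centroAffineCurvature γ u ^ a * areaSpeed γ u)) :
    ∫ u in (0 : ℝ)..(2 * Real.pi), lengthRate a γ V u =
      (4 * a - 2) * (∫ u in (0 : ℝ)..(2 * Real.pi),
        (centroAffineCurvature γ u ^ a) ^ 2 * areaSpeed γ u) +
      (1 - a) * ∫ u in (0 : ℝ)..(2 * Real.pi),
        deriv (fun v => centroAffineCurvature γ v ^ a) u ^ 2 /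
          (centroAffineCurvature γ u * areaSpeed γ u) := by
  have hφ := h.contDiff_rpow a
  have hφ1 : Continuous (deriv fun v => centroAffineCurvature γ v ^ a) :=
    hφ.continuous_deriv (by simp)
  have c1 := h.continuous_lengthRate a hV
  have c2 : Continuous fun u => (centroAffineCurvature γ u ^ a) ^ 2 * areaSpeed γ u :=
    (hφ.continuous.pow 2).mul h.continuous_areaSpeed
  have c3 : Continuous fun u => deriv (fun v => centroAffineCurvature γ v ^ a) u ^ 2 /
      (centroAffineCurvature γ u * areaSpeed γ u) :=
    (hφ1.pow 2).div (h.contDiff_centroAffineCurvature.continuous.mul h.continuous_areaSpeed)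
      fun u => (mul_pos (h.centroAffineCurvature_pos u) (h.areaSpeed_pos u)).ne'
  have c4 : Continuous fun u => (4 * a - 2) *
      ((centroAffineCurvature γ u ^ a) ^ 2 * areaSpeed γ u) + (1 - a) *
        (deriv (fun v => centroAffineCurvature γ v ^ a) u ^ 2 /
          (centroAffineCurvature γ u * areaSpeed γ u)) := (c2.const_mul _).add (c3.const_mul _)
  have hφp : deriv (fun v => centroAffineCurvature γ v ^ a) (2 * Real.pi) =
      deriv (fun v => centroAffineCurvature γ v ^ a) 0 := by
    have := deriv_comp_add_const (fun v => centroAffineCurvature γ v ^ a) (2 * Real.pi) 0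
    simp only [h.periodic_centroAffineCurvature _, zero_add] at this
    exact this.symm
  have hper : ∀ {E : Type} {f : ℝ → E}, Function.Periodic f (2 * Real.pi) →
      f (2 * Real.pi) = f 0 := fun hf => by simpa using hf 0
  have hint := intervalIntegral.integral_eq_sub_of_hasDerivAt
    (fun u _ => h.hasDerivAt_lengthRate_primitive hV hVn u)
    ((c1.sub c4).intervalIntegrable 0 (2 * Real.pi))
  rw [hper h.periodic, hper hVp, hper h.periodic_centroAffineCurvature,
    hper h.periodic_areaSpeed, hφp, sub_self,
    intervalIntegral.integral_sub (c1.intervalIntegrable _ _)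
      (c4.intervalIntegrable _ _),
    intervalIntegral.integral_add ((c2.const_mul _).intervalIntegrable _ _)
      ((c3.const_mul _).intervalIntegrable _ _), intervalIntegral.integral_const_mul,
    intervalIntegral.integral_const_mul] at hint
  linarith

end IsSymBoundary

/-! ### Calculus on the space-time strip -/

/-- Differentiation under the integral sign on a time interval, one-sided at its left end. -/
theorem hasDerivWithinAt_intervalIntegral {F F' : ℝ → ℝ → ℝ} {a b T t : ℝ} (ht : t ∈ Ico 0 T)
    (hF : ∀ τ ∈ Ico 0 T, Continuous fun u => F u τ)
    (hF' : ContinuousOn (fun q : ℝ × ℝ => F' q.1 q.2) (univ ×ˢ Ico 0 T))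
    (hd : ∀ u, ∀ τ ∈ Ico 0 T, HasDerivWithinAt (F u) (F' u τ) (Ico 0 T) τ) :
    HasDerivWithinAt (fun τ => ∫ u in a..b, F u τ) (∫ u in a..b, F' u t) (Ico 0 T) t := by
  obtain ⟨t₁, ht₁, ht₁T⟩ := exists_between ht.2
  have hsub : Icc 0 t₁ ⊆ Ico 0 T := fun τ hτ => ⟨hτ.1, hτ.2.trans_lt ht₁T⟩
  obtain ⟨C, hC⟩ := (isCompact_uIcc (a := a) (b := b)).prod (isCompact_Icc (a := 0) (b := t₁))
    |>.exists_bound_of_continuousOn (hF'.mono (prod_mono (subset_univ _) hsub))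
  rw [hasDerivWithinAt_iff_tendsto_slope]
  have hev : ∀ᶠ τ in nhdsWithin t (Ico 0 T \ {t}), τ ∈ Icc 0 t₁ := by
    filter_upwards [self_mem_nhdsWithin, nhdsWithin_le_nhds (Iio_mem_nhds ht₁)] with τ h1 h2
    exact ⟨h1.1.1, h2.le⟩
  have hslope : ∀ᶠ τ in nhdsWithin t (Ico 0 T \ {t}),
      ∫ u in a..b, slope (F u) t τ = slope (fun τ => ∫ u in a..b, F u τ) t τ := by
    filter_upwards [hev] with τ hτ
    simp only [slope_def_module, smul_eq_mul]
    rw [intervalIntegral.integral_const_mul, intervalIntegral.integral_sub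
      ((hF τ (hsub hτ)).intervalIntegrable _ _) ((hF t ht).intervalIntegrable _ _)]
  refine Filter.Tendsto.congr' hslope ?_
  refine intervalIntegral.tendsto_integral_filter_of_dominated_convergence (fun _ => C) ?_ ?_
    intervalIntegrable_const ?_
  · filter_upwards [hev] with τ hτ
    simp only [slope_def_module, smul_eq_mul]
    exact (((hF τ (hsub hτ)).sub (hF t ht)).const_mul _).aestronglyMeasurable
  · filter_upwards [hev, self_mem_nhdsWithin] with τ hτ hτ'
    refine Filter.Eventually.of_forall fun u hu => ?_
    have h1 := (convex_Icc 0 t₁).norm_image_sub_le_of_norm_hasDerivWithin_le (f := F u)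
      (fun s hs => (hd u s (hsub hs)).mono hsub)
      (fun s hs => hC (u, s) ⟨uIoc_subset_uIcc hu, hs⟩) ⟨ht.1, ht₁.le⟩ hτ
    have h2 : 0 < ‖τ - t‖ := norm_pos_iff.2 (sub_ne_zero.2 hτ'.2)
    rw [slope_def_module, norm_smul, norm_inv, inv_mul_le_iff₀ h2]
    linarith
  · refine Filter.Eventually.of_forall fun u _ => ?_
    exact hasDerivWithinAt_iff_tendsto_slope.1 (hd u t ht)

section Partial

variable {E : Type*} [NormedAddCommGroup E] [NormedSpace ℝ E] {T : ℝ} {f : ℝ × ℝ → E}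

/-- The space-time domain `ℝ × [0, T)`. -/
def strip (T : ℝ) : Set (ℝ × ℝ) := univ ×ˢ Ico 0 T

/-- The partial derivative in the curve parameter, of a function on `ℝ × [0, T)`. -/
noncomputable def partialSpace (T : ℝ) (f : ℝ × ℝ → E) (q : ℝ × ℝ) : E :=
  fderivWithin ℝ f (strip T) q (1, 0)

/-- The partial derivative in time, one-sided at time `0`, of a function on `ℝ × [0, T)`. -/
noncomputable def partialTime (T : ℝ) (f : ℝ × ℝ → E) (q : ℝ × ℝ) : E :=
  fderivWithin ℝ f (strip T) q (0, 1)

theorem uniqueDiffOn_strip (T : ℝ) : UniqueDiffOn ℝ (strip T) :=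
  uniqueDiffOn_univ.prod (uniqueDiffOn_Ico 0 T)

theorem contDiffOn_partialSpace (hf : ContDiffOn ℝ ∞ f (strip T)) :
    ContDiffOn ℝ ∞ (partialSpace T f) (strip T) :=
  (hf.fderivWithin (uniqueDiffOn_strip T) (by simp)).clm_apply contDiffOn_const

theorem contDiffOn_partialTime (hf : ContDiffOn ℝ ∞ f (strip T)) :
    ContDiffOn ℝ ∞ (partialTime T f) (strip T) :=
  (hf.fderivWithin (uniqueDiffOn_strip T) (by simp)).clm_apply contDiffOn_const

theorem hasDerivAt_partialSpace (hf : ContDiffOn ℝ ∞ f (strip T)) {u t : ℝ} (ht : t ∈ Ico 0 T) :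
    HasDerivAt (fun v => f (v, t)) (partialSpace T f (u, t)) u := by
  have h1 := (hf.differentiableOn (by simp) (u, t) ⟨mem_univ _, ht⟩).hasFDerivWithinAt
  have h2 : HasDerivWithinAt (fun v : ℝ => (v, t)) ((1 : ℝ), (0 : ℝ)) univ u :=
    ((hasDerivAt_id u).prodMk (hasDerivAt_const u t)).hasDerivWithinAt
  rw [← hasDerivWithinAt_univ]
  exact h1.comp_hasDerivWithinAt u h2 (t := strip T) fun v _ => ⟨mem_univ v, ht⟩

theorem hasDerivWithinAt_partialTime (hf : ContDiffOn ℝ ∞ f (strip T)) {u t : ℝ}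
    (ht : t ∈ Ico 0 T) :
    HasDerivWithinAt (fun τ => f (u, τ)) (partialTime T f (u, t)) (Ico 0 T) t := by
  have h1 := (hf.differentiableOn (by simp) (u, t) ⟨mem_univ _, ht⟩).hasFDerivWithinAt
  have h2 : HasDerivWithinAt (fun τ : ℝ => (u, τ)) ((0 : ℝ), (1 : ℝ)) (Ico 0 T) t :=
    ((hasDerivAt_const t u).prodMk (hasDerivAt_id t)).hasDerivWithinAt
  exact h1.comp_hasDerivWithinAt t h2 (t := strip T) fun τ hτ => ⟨mem_univ u, hτ⟩

theorem contDiff_slice (hf : ContDiffOn ℝ ∞ f (strip T)) {t : ℝ} (ht : t ∈ Ico 0 T) :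
    ContDiff ℝ ∞ fun u => f (u, t) := by
  rw [← contDiffOn_univ]
  exact hf.comp (contDiff_id.prodMk contDiff_const).contDiffOn fun u _ => ⟨mem_univ _, ht⟩

theorem partialSpace_partialTime (hf : ContDiffOn ℝ ∞ f (strip T)) {q : ℝ × ℝ}
    (hq : q ∈ strip T) :
    partialSpace T (partialTime T f) q = partialTime T (partialSpace T f) q := by
  have hT : 0 < T := hq.2.1.trans_lt hq.2.2
  have hcl : q ∈ closure (interior (strip T)) := by
    rw [strip, interior_prod_eq, interior_univ, interior_Ico, closure_prod_eq, closure_univ,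
      closure_Ioo hT.ne]
    exact ⟨mem_univ _, Ico_subset_Icc_self hq.2⟩
  have hsymm : IsSymmSndFDerivWithinAt ℝ f (strip T) q :=
    (hf q hq).isSymmSndFDerivWithinAt 
      (by simpa using (WithTop.coe_le_coe.2 (le_top : (2 : ℕ∞) ≤ ⊤))) (uniqueDiffOn_strip T) hcl hq
  have hd : DifferentiableWithinAt ℝ (fderivWithin ℝ f (strip T)) (strip T) q :=
    (hf.fderivWithin (uniqueDiffOn_strip T) (m := ∞) (by simp)).differentiableOn (by simp) q hq
  have happ : ∀ v w : ℝ × ℝ, fderivWithin ℝ (fun r => fderivWithin ℝ f (strip T) r v) (strip T) q w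
      = fderivWithin ℝ (fderivWithin ℝ f (strip T)) (strip T) q w v := fun v w => by
    rw [fderivWithin_clm_apply (uniqueDiffOn_strip T q hq) hd (differentiableWithinAt_const v)]
    simp
  unfold partialSpace partialTime
  rw [happ, happ]
  exact hsymm _ _

end Partial

/-! ### The flow -/

namespace IsContractingFlow

variable {p T : ℝ} {K : ℝ → ConvexBody Plane} {x : ℝ → ℝ → Plane}

/-- The velocity `∂x/∂t` of the flow. -/
noncomputable def velocity (T : ℝ) (x : ℝ → ℝ → Plane) (t u : ℝ) : Plane :=
  partialTime T (fun w => x w.1 w.2) (u, t)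

theorem contDiffOn (h : IsContractingFlow p T K x) :
    ContDiffOn ℝ ∞ (fun w : ℝ × ℝ => x w.1 w.2) (strip T) := h.smooth

theorem contDiff_velocity (h : IsContractingFlow p T K x) {t : ℝ} (ht : t ∈ Ico 0 T) :
    ContDiff ℝ ∞ (velocity T x t) :=
  contDiff_slice (contDiffOn_partialTime h.contDiffOn) ht

theorem deriv_eq (h : IsContractingFlow p T K x) {t : ℝ} (ht : t ∈ Ico 0 T) :
    deriv (fun u => x u t) = fun u => partialSpace T (fun w => x w.1 w.2) (u, t) :=
  funext fun _ => (hasDerivAt_partialSpace h.contDiffOn ht).deriv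

theorem deriv_deriv_eq (h : IsContractingFlow p T K x) {t : ℝ} (ht : t ∈ Ico 0 T) :
    deriv (deriv fun u => x u t) =
      fun u => partialSpace T (partialSpace T fun w => x w.1 w.2) (u, t) := by
  rw [h.deriv_eq ht]
  exact funext fun _ => (hasDerivAt_partialSpace (contDiffOn_partialSpace h.contDiffOn) ht).deriv

theorem deriv_velocity_eq (h : IsContractingFlow p T K x) {t : ℝ} (ht : t ∈ Ico 0 T) :
    deriv (velocity T x t) =
      fun u => partialTime T (partialSpace T fun w => x w.1 w.2) (u, t) :=
  funext fun u => ((hasDerivAt_partialSpace (contDiffOn_partialTime h.contDiffOn) ht).deriv).trans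
    (partialSpace_partialTime h.contDiffOn (q := (u, t)) ⟨mem_univ _, ht⟩)

theorem deriv_deriv_velocity_eq (h : IsContractingFlow p T K x) {t : ℝ} (ht : t ∈ Ico 0 T) :
    deriv (deriv (velocity T x t)) =
      fun u => partialTime T (partialSpace T (partialSpace T fun w => x w.1 w.2)) (u, t) := by
  have h1 := contDiffOn_partialSpace h.contDiffOn
  rw [h.deriv_velocity_eq ht]
  exact funext fun u => ((hasDerivAt_partialSpace (contDiffOn_partialTime h1) ht).deriv).trans
    (partialSpace_partialTime h1 (q := (u, t)) ⟨mem_univ _, ht⟩)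

theorem periodic_velocity (h : IsContractingFlow p T K x) {t : ℝ} (ht : t ∈ Ico 0 T) :
    Function.Periodic (velocity T x t) (2 * Real.pi) := by
  intro u
  have h1 := hasDerivWithinAt_partialTime h.contDiffOn (u := u + 2 * Real.pi) ht
  have h2 := hasDerivWithinAt_partialTime h.contDiffOn (u := u) ht
  exact (uniqueDiffOn_Ico 0 T t ht).eq_deriv _ h1
    (h2.congr (fun τ hτ => (h.boundary τ hτ).periodic u) ((h.boundary t ht).periodic u))

/-- The flow equation in centro-affine terms. -/
theorem bracket_velocity (h : IsContractingFlow p T K x) {t : ℝ} (ht : t ∈ Ico 0 T) (u : ℝ) :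
    bracket (velocity T x t u) (deriv (fun v => x v t) u) =
      -(centroAffineCurvature (fun v => x v t) u ^ (p / (p + 2)) *
        areaSpeed (fun v => x v t) u) := by
  have hb := h.boundary t ht
  have hne := hb.deriv_ne_zero u
  have hk := hb.centroAffineCurvature_pos u
  have hD := hb.areaSpeed_pos u
  have h1 := h.evolution u t ht
  have h2 : derivWithin (fun τ => x u τ) (Ico 0 T) t = velocity T x t u :=
    (hasDerivWithinAt_partialTime h.contDiffOn ht).derivWithin (uniqueDiffOn_Ico 0 T t ht)
  rw [h2] at h1
  have hn : 0 < ‖deriv (fun v => x v t) u‖ := norm_pos_iff.2 hne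
  -- `κ = κ₀ s³`
  have h3 : curvature (fun v => x v t) u = centroAffineCurvature (fun v => x v t) u *
      (areaSpeed (fun v => x v t) u / ‖deriv (fun v => x v t) u‖) ^ 3 := by
    rw [curvature, hb.bracket_deriv_eq]
    field_simp
  have h4 : curvature (fun v => x v t) u ^ (1 / 3 : ℝ) =
      centroAffineCurvature (fun v => x v t) u ^ (1 / 3 : ℝ) *
        (areaSpeed (fun v => x v t) u / ‖deriv (fun v => x v t) u‖) := by
    rw [h3, Real.mul_rpow hk.le (by positivity), ← Real.rpow_natCast,
      ← Real.rpow_mul (by positivity)]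
    norm_num
  rw [← norm_deriv_mul_inner_outerNormal hne, h1, h4, Real.rpow_sub hk]
  have := (Real.rpow_pos_of_pos hk (1 / 3)).ne'
  field_simp

/-- The rate of change of the density of the affine length, in terms of partial derivatives on
space-time, with the time derivative taken last. -/
theorem lengthRate_velocity_eq (h : IsContractingFlow p T K x) (a : ℝ) (u : ℝ) {t : ℝ}
    (ht : t ∈ Ico 0 T) {X : ℝ × ℝ → Plane} (hX : X = fun w => x w.1 w.2) :
    lengthRate a (fun v => x v t) (velocity T x t) u =
      centroAffineCurvature (fun v => x v t) u ^ a *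
        (bracket (partialTime T X (u, t)) (partialSpace T X (u, t)) +
          bracket (X (u, t)) (partialTime T (partialSpace T X) (u, t))) +
      a * centroAffineCurvature (fun v => x v t) u ^ (a - 1) *
        ((bracket (partialTime T (partialSpace T X) (u, t))
              (partialSpace T (partialSpace T X) (u, t)) +
            bracket (partialSpace T X (u, t))
              (partialTime T (partialSpace T (partialSpace T X)) (u, t))) /
            areaSpeed (fun v => x v t) u ^ 3 -
          3 * centroAffineCurvature (fun v => x v t) u *
            (bracket (partialTime T X (u, t)) (partialSpace T X (u, t)) +
              bracket (X (u, t)) (partialTime T (partialSpace T X) (u, t))) /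
            areaSpeed (fun v => x v t) u) * areaSpeed (fun v => x v t) u := by
  subst hX
  simp only [lengthRate]
  rw [h.deriv_deriv_velocity_eq ht, h.deriv_velocity_eq ht, h.deriv_deriv_eq ht, h.deriv_eq ht]
  rfl

theorem hasDerivWithinAt_density (h : IsContractingFlow p T K x) (a : ℝ) (u : ℝ) {t : ℝ}
    (ht : t ∈ Ico 0 T) :
    HasDerivWithinAt (fun τ => centroAffineCurvature (fun v => x v τ) u ^ a *
        areaSpeed (fun v => x v τ) u)
      (lengthRate a (fun v => x v t) (velocity T x t) u) (Ico 0 T) t := by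
  have hb := h.boundary t ht
  obtain ⟨X, hX⟩ : ∃ X : ℝ × ℝ → Plane, X = fun w => x w.1 w.2 := ⟨_, rfl⟩
  have s0 : ContDiffOn ℝ ∞ X (strip T) := hX ▸ h.contDiffOn
  have s1 := contDiffOn_partialSpace s0
  have d0 := hasDerivWithinAt_partialTime s0 (u := u) ht
  have d1 := hasDerivWithinAt_partialTime s1 (u := u) ht
  have d2 := hasDerivWithinAt_partialTime (contDiffOn_partialSpace s1) (u := u) ht
  have e1 : ∀ τ ∈ Ico 0 T, areaSpeed (fun v => x v τ) u =
      bracket (X (u, τ)) (partialSpace T X (u, τ)) := fun τ hτ => by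
    rw [areaSpeed, h.deriv_eq hτ, hX]
  have dD := (hasDerivWithinAt_bracket d0 d1).congr e1 (e1 t ht)
  have e2 : ∀ τ ∈ Ico 0 T, bracket (deriv (fun v => x v τ) u) (deriv (deriv fun v => x v τ) u) =
      bracket (partialSpace T X (u, τ)) (partialSpace T (partialSpace T X) (u, τ)) :=
    fun τ hτ => by rw [h.deriv_deriv_eq hτ, h.deriv_eq hτ, hX]
  have dB := (hasDerivWithinAt_bracket d1 d2).congr e2 (e2 t ht)
  have hD := (hb.areaSpeed_pos u).ne'
  have hk := (hb.centroAffineCurvature_pos u).ne'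
  have dk := (dB.div (dD.pow 3) (pow_ne_zero 3 hD)).congr
    (fun τ hτ => centroAffineCurvature_eq ((h.boundary τ hτ).deriv_ne_zero u))
    (centroAffineCurvature_eq (hb.deriv_ne_zero u))
  refine ((dk.rpow_const (p := a) (Or.inl hk)).mul dD).congr_deriv ?_
  rw [h.lengthRate_velocity_eq a u ht hX, hb.bracket_deriv_eq u]
  simp only [Pi.pow_apply]
  field_simp
  push_cast
  ring

theorem continuousOn_lengthRate (h : IsContractingFlow p T K x) (a : ℝ) :
    ContinuousOn (fun q : ℝ × ℝ => lengthRate a (fun v => x v q.2) (velocity T x q.2) q.1)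
      (univ ×ˢ Ico 0 T) := by
  obtain ⟨X, hX⟩ : ∃ X : ℝ × ℝ → Plane, X = fun w => x w.1 w.2 := ⟨_, rfl⟩
  have s0 : ContDiffOn ℝ ∞ X (strip T) := hX ▸ h.contDiffOn
  have s1 := contDiffOn_partialSpace s0
  have s2 := contDiffOn_partialSpace s1
  have sD : ContDiffOn ℝ ∞ (fun q : ℝ × ℝ => areaSpeed (fun v => x v q.2) q.1) (strip T) :=
    (contDiffOn_bracket s0 s1).congr fun q hq => by
      rw [areaSpeed, h.deriv_eq hq.2, hX]
  have hDpos : ∀ q ∈ strip T, areaSpeed (fun v => x v q.2) q.1 ≠ 0 := fun q hq =>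
    ((h.boundary _ hq.2).areaSpeed_pos _).ne'
  have cD := sD.continuousOn
  have ck : ContinuousOn (fun q : ℝ × ℝ => centroAffineCurvature (fun v => x v q.2) q.1)
      (strip T) :=
    ((contDiffOn_bracket s1 s2).continuousOn.div (cD.pow 3)
      fun q hq => pow_ne_zero 3 (hDpos q hq)).congr fun q hq => by
        rw [centroAffineCurvature_eq ((h.boundary _ hq.2).deriv_ne_zero _), h.deriv_deriv_eq hq.2,
          h.deriv_eq hq.2, hX]
        rfl
  have ckr : ∀ b : ℝ, ContinuousOn
      (fun q : ℝ × ℝ => centroAffineCurvature (fun v => x v q.2) q.1 ^ b) (strip T) := fun b =>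
    ck.rpow_const fun q hq => Or.inl ((h.boundary _ hq.2).centroAffineCurvature_pos _).ne'
  have b1 := (contDiffOn_bracket (contDiffOn_partialTime s0) s1).continuousOn
  have b2 := (contDiffOn_bracket s0 (contDiffOn_partialTime s1)).continuousOn
  have b3 := (contDiffOn_bracket (contDiffOn_partialTime s1) s2).continuousOn
  have b4 := (contDiffOn_bracket s1 (contDiffOn_partialTime s2)).continuousOn
  refine (((ckr a).mul (b1.add b2)).add ((((continuousOn_const (c := a)).mul (ckr (a - 1))).mul
    (((b3.add b4).div (cD.pow 3) fun q hq => pow_ne_zero 3 (hDpos q hq)).sub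
      ((((continuousOn_const (c := (3 : ℝ))).mul ck).mul (b1.add b2)).div cD
        hDpos))).mul cD)).congr fun q hq => ?_
  rw [h.lengthRate_velocity_eq a q.1 hq.2 hX]
  rfl

/-- The first variation of the `p`-affine length along the flow. -/
theorem hasDerivWithinAt_affineLength (h : IsContractingFlow p T K x) {t : ℝ} (ht : t ∈ Ico 0 T) :
    HasDerivWithinAt (fun τ => affineLength p fun u => x u τ)
      ((4 * (p / (p + 2)) - 2) * (∫ u in (0 : ℝ)..(2 * Real.pi),
        (centroAffineCurvature (fun v => x v t) u ^ (p / (p + 2))) ^ 2 *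
          areaSpeed (fun v => x v t) u) +
      (1 - p / (p + 2)) * ∫ u in (0 : ℝ)..(2 * Real.pi),
        deriv (fun v => centroAffineCurvature (fun v => x v t) v ^ (p / (p + 2))) u ^ 2 /
          (centroAffineCurvature (fun v => x v t) u * areaSpeed (fun v => x v t) u))
      (Ico 0 T) t := by
  rw [← (h.boundary t ht).integral_lengthRate (h.contDiff_velocity ht) (h.periodic_velocity ht)
    (h.bracket_velocity ht)]
  have hI := hasDerivWithinAt_intervalIntegral (a := 0) (b := 2 * Real.pi)
    (F := fun u τ => centroAffineCurvature (fun v => x v τ) u ^ (p / (p + 2)) *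
      areaSpeed (fun v => x v τ) u)
    (F' := fun u τ => lengthRate (p / (p + 2)) (fun v => x v τ) (velocity T x τ) u) ht
    (fun τ hτ => ((h.boundary τ hτ).contDiff_rpow _).continuous.mul
      (h.boundary τ hτ).continuous_areaSpeed)
    (h.continuousOn_lengthRate _) fun u τ hτ => h.hasDerivWithinAt_density _ u hτ
  exact hI.congr (fun τ hτ => (h.boundary τ hτ).affineLength_eq p)
    ((h.boundary t ht).affineLength_eq p)

end IsContractingFlow

end CentroAffine

theorem mainTheorem3 (p T : ℝ) (hp : 1 ≤ p)
    (K : ℝ → ConvexBody CentroAffine.Plane) (x : ℝ → ℝ → CentroAffine.Plane)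
    (hflow : CentroAffine.IsContractingFlow p T K x) :
    ∀ t ∈ Set.Ico 0 T, ∃ dΩ : ℝ,
      HasDerivWithinAt (fun τ => CentroAffine.affineLength p (fun u => x u τ)) dΩ
        (Set.Ico 0 T) t ∧
      (p ≤ 2 →
        dΩ ≥ (p - 2) / (p + 2) *
            (CentroAffine.affineLength p (fun u => x u t) ^ 2 / CentroAffine.area (K t)) +
          18 * (p - 1) * p ^ 2 / (p + 2) ^ 3 *
            CentroAffine.affineEnergy p (fun u => x u t)) ∧
      (2 ≤ p →
        dΩ ≥ (p - 2) / (p + 2) *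
            (CentroAffine.affineLength p (fun u => x u t) ^ 2 / CentroAffine.area (K t)) +
          18 * p ^ 2 / (p + 2) ^ 3 *
            CentroAffine.affineEnergy p (fun u => x u t)) := by
  intro t ht
  have hp2 : 0 < p + 2 := by linarith
  have hb := hflow.boundary t ht
  have hder := hflow.hasDerivWithinAt_affineLength ht
  have hcs := hb.sq_integral_le (hb.contDiff_rpow (p / (p + 2))).continuous
  have hw := hb.wirtinger (p / (p + 2))
  have hE := hb.affineEnergy_eq (p := p) (by linarith)
  have hA := hb.area_pos
  rw [← hb.affineLength_eq] at hcs hw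
  rw [← hE] at hder hw
  refine ⟨_, hder, ?_, ?_⟩ <;>
  generalize (∫ u in (0 : ℝ)..(2 * Real.pi),
        (CentroAffine.centroAffineCurvature (fun v => x v t) u ^ (p / (p + 2))) ^ 2 *
          CentroAffine.areaSpeed (fun v => x v t) u) = I at hcs hw ⊢ <;>
  generalize CentroAffine.affineEnergy p (fun u => x u t) = E at hw ⊢ <;>
  generalize CentroAffine.affineLength p (fun u => x u t) = Ω at hcs hw ⊢ <;>
  generalize CentroAffine.area (K t) = A at hA hcs hw ⊢ <;>
  intro hp'
  -- the two sides differ by a nonnegative multiple of the slack in Wirtinger's inequality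
  · have h1 : 0 ≤ (2 - p) / (p + 2) *
        (2 * (9 * (p / (p + 2)) ^ 2 * E - (I - Ω ^ 2 / (2 * A)))) :=
      mul_nonneg (div_nonneg (by linarith) hp2.le) (by linarith)
    rw [ge_iff_le, ← sub_nonneg]
    refine h1.trans_eq ?_
    field_simp
    ring
  -- here they differ by a nonnegative multiple of the slack in the Cauchy-Schwarz inequality
  · have h1 : 0 ≤ (p - 2) / (p + 2) * (2 * (I - Ω ^ 2 / (2 * A))) :=
      mul_nonneg (div_nonneg (by linarith) hp2.le) (by linarith)
    rw [ge_iff_le, ← sub_nonneg]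
    refine h1.trans_eq ?_
    field_simp
    ring
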